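/- **Setting.** Let $d\in\{1,2,3\}$, let $\hat\Omega\subset\mathbb R^d$ be the interior of the union of the closed cells $\hat K$ of a conforming simplicial mesh, and let $\hat V_h$ be a finite-dimensional space of functions in $H^1_0(\hat\Omega)$ that are continuous and, on each $\hat K$, smooth ($C^2$, e.g. polynomial) up to the boundary. Let $N\ge 0$, $\Delta t>0$, $t^n=n\Delta t$. Let $\mathcal A^n$ ($0\le n\le N+1$) be continuous maps that are affine on each $\hat K$, such that for $0\le n\le N$ and every $\tau\in[t^n,t^{n+1}]$ the linear interpolation in time of $\mathcal A^n,\mathcal A^{n+1}$ is injective on the closure of $\hat\Omega$ and maps $\hat\Omega$ onto a domain $\Omega_\tau$; denote it by $\mathcal A_\tau$. Functions $\hat v\in\hat V_h$ are identified with $\hat v\circ\mathcal A_\tau^{-1}$ on $\Omega_\tau$. The cells of $\Omega_{t^{n+1/2}}$, $t^{n+1/2}=(n+\tfrac12)\Delta t$, are $K=\mathcal A_{t^{n+1/2}}(\hat K)$, of diameter $h_K$, and the mesh velocity there is $\mathbf w_h^{n+1/2}=\frac{\mathcal A^{n+1}-\mathcal A^n}{\Delta t}\circ\mathcal A_{t^{n+1/2}}^{-1}$.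 If $d=3$, assume that the midpoint rule satisfies the geometric conservation law $$\|v\|^2_{L^2(\Omega_{t^{n+1}})}-\|v\|^2_{L^2(\Omega_{t^{n}})}=\Delta t\int_{\Omega_{t^{n+1/2}}}|v|^2\,\nabla\cdot\mathbf w_h^{n+1/2}\,dx\qquad(v\in\hat V_h,\ 0\le n\le N)$$ (for $d\le2$ it holds automatically). Let $\varepsilon,\mu>0$ be constants and, at each time $t^{n+1/2}$, let $\mathbf b$ be Lipschitz, $c$ bounded and $f$ square integrable on $\Omega_{t^{n+1/2}}$, with $c-\frac12\nabla\cdot\mathbf b\ge\mu$ a.e. Let $c_{inv}\ge0$ satisfy $\|\Delta v\|_{0,K}\le c_{inv}h_K^{-1}|v|_{1,K}$ for all $v\in\hat V_h$ and all $K$, and let the stabilization parameters $\delta_K\ge0$ (which may depend on $n$) satisfy $$2\|c\|_{K,\infty}^2\,\delta_K\le\mu,\qquad 2\varepsilon c_{inv}^2\,\delta_K\le h_K^2,\qquad \delta_K\le\frac{\Delta t}{4}.$$ All data being taken at $t^{n+1/2}$, with $\mathbf w_h=\mathbf w_h^{n+1/2}$, put $$a^{n+1/2}_{SUPG}(u,v)=\varepsilon(\nabla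 u,\nabla v)+(\mathbf b\cdot\nabla u,v)+(cu,v)+\sum_K\delta_K\big(-\varepsilon\Delta u+(\mathbf b-\mathbf w_h)\cdot\nabla u+cu,\ (\mathbf b-\mathbf w_h)\cdot\nabla v\big)_K,$$ $$|||u|||^2=\varepsilon|u|_1^2+\sum_K\delta_K\|(\mathbf b-\mathbf w_h)\cdot\nabla u\|^2_{0,K}+\mu\|u\|_0^2$$ on $\Omega_{t^{n+1/2}}$. Let $u_h^0,\dots,u_h^{N+1}\in\hat V_h$ solve the Crank–Nicolson conservative ALE-SUPG scheme: for $0\le n\le N$ and all $v\in\hat V_h$, with $\bar u=\frac12(u_h^{n+1}+u_h^n)$, $$(u_h^{n+1},v)_{\Omega_{t^{n+1}}}-(u_h^n,v)_{\Omega_{t^n}}+\Delta t\,a^{n+1/2}_{SUPG}(\bar u,v)-\Delta t\int_{\Omega_{t^{n+1/2}}}\nabla\cdot(\mathbf w_h\bar u)\,v\,dx=\Delta t\,(f^{n+1/2},v)_{\Omega_{t^{n+1/2}}}+\Delta t\sum_K\delta_K\big(f^{n+1/2},(\mathbf b-\mathbf w_h)\cdot\nabla v\big)_K .$$ For $0\le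 n\le N$ put $$\beta_1^{n+1}=\tfrac12\|\nabla\cdot\mathbf w_h^{n+1/2}\|_{L^\infty(\Omega_{t^{n+1/2}})}\|J_{t^{n+1},t^{n+1/2}}\|_{L^\infty(\Omega_{t^{n+1}})},\qquad \beta_2^{n}=\tfrac12\|\nabla\cdot\mathbf w_h^{n+1/2}\|_{L^\infty(\Omega_{t^{n+1/2}})}\|J_{t^{n},t^{n+1/2}}\|_{L^\infty(\Omega_{t^{n}})},$$ where $J_{s,t}=|\det D(\mathcal A_t\circ\mathcal A_s^{-1})|$, and put $\beta_2^{N+1}=0$. **Statement.** If $\Delta t\,(\beta_1^n+\beta_2^n)<1$ for $1\le n\le N+1$, then $$\|u_h^{N+1}\|^2_{L^2(\Omega_{t^{N+1}})}+\frac{\Delta t}{8}\sum_{n=0}^N|||u_h^{n+1}+u_h^n|||^2\le\Big((1+\Delta t\beta_2^0)\|u_h^0\|^2_{L^2(\Omega_{0})}+\Delta t\sum_{n=0}^N\Big(\frac2\mu+\frac{\Delta t}{2}\Big)\|f^{n+1/2}\|^2_{L^2(\Omega_{t^{n+1/2}})}\Big)\exp\Big(\Delta t\sum_{n=1}^{N+1}\frac{\beta_1^n+\beta_2^n}{1-\Delta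 t(\beta_1^n+\beta_2^n)}\Big).$$ If moreover $f^{n+1/2}=0$ for all $0\le n\le N$, the same bound holds with $\frac{\Delta t}{4}$ in place of $\frac{\Delta t}{8}$. -/

import Mathlib

noncomputable section

namespace ALESUPG

open MeasureTheory Set

/-- The ambient Euclidean space `ℝ^d`. -/
abbrev Pt (d : ℕ) : Type := EuclideanSpace ℝ (Fin d)

/-- A conforming mesh of non-degenerate `d`-simplices, each given by its set of vertices. -/
structure Mesh (d : ℕ) where
  cells : Finset (Finset (Pt d))
  card_eq : ∀ K ∈ cells, K.card = d + 1
  indep : ∀ K ∈ cells, AffineIndependent ℝ ((↑) : K → Pt d)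
  inter_eq : ∀ K ∈ cells, ∀ L ∈ cells,
    convexHull ℝ (K : Set (Pt d)) ∩ convexHull ℝ (L : Set (Pt d)) =
      convexHull ℝ ((K : Set (Pt d)) ∩ (L : Set (Pt d)))

/-- The closed simplex with vertex set `K`. -/
def cell {d : ℕ} (K : Finset (Pt d)) : Set (Pt d) := convexHull ℝ (K : Set (Pt d))

/-- The closed triangulated reference region: the union of the closed cells. Its interior is the
reference domain. -/
def Mesh.region {d : ℕ} (M : Mesh d) : Set (Pt d) := ⋃ K ∈ M.cells, cell K

/-- The moved (closed) domain, the image of the reference region under `A`. -/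
def Mesh.moved {d : ℕ} (M : Mesh d) (A : Pt d → Pt d) : Set (Pt d) := A '' M.region

/-- `A` is a discrete (piecewise affine) ALE map: affine on every closed reference cell (hence
continuous on the reference region), injective, and mapping the reference domain onto an open
set. -/
structure IsALEMap {d : ℕ} (M : Mesh d) (A : Pt d → Pt d) : Prop where
  affine_on : ∀ K ∈ M.cells, ∃ g : Pt d →ᵃ[ℝ] Pt d, EqOn A g (cell K)
  injOn : InjOn A M.region
  isOpen_image : IsOpen (A '' interior M.region)

/-- Linear interpolation in time between two ALE maps. -/
def interp {d : ℕ} (A₀ A₁ : Pt d → Pt d) (θ : ℝ) : Pt d → Pt d :=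
  fun Y => (1 - θ) • A₀ Y + θ • A₁ Y

/-- `v ∘ A⁻¹`: the Eulerian function on the moved domain `M.moved A` that belongs to the function
`v` on the reference region. -/
def push {d : ℕ} {F : Type*} (M : Mesh d) (A : Pt d → Pt d) (v : Pt d → F) : Pt d → F :=
  fun x => v (Function.invFunOn A M.region x)

/-- Functions of an `H¹₀`-conforming finite element space on the reference domain (extended by
zero): continuous, zero outside the domain, and smooth up to the boundary of every cell
(for instance, polynomial on every cell). -/
structure IsConforming {d : ℕ} (M : Mesh d) (v : Pt d → ℝ) : Prop where
  continuous : Continuous v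
  zero_outside : ∀ Y, Y ∉ interior M.region → v Y = 0
  smooth_on : ∀ K ∈ M.cells, ∃ g : Pt d → ℝ, ContDiff ℝ 2 g ∧ EqOn v g (cell K)

/-- The divergence of a vector field. -/
def diverg {d : ℕ} (w : Pt d → Pt d) (x : Pt d) : ℝ :=
  ∑ i : Fin d, (fderiv ℝ w x (EuclideanSpace.single i 1)) i

/-- `‖g‖²` in `L²(S)`. -/
def l2sq {d : ℕ} (S : Set (Pt d)) (g : Pt d → ℝ) : ℝ := ∫ x in S, (g x) ^ 2

/-- `‖g‖` in `L^∞(S)`. -/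
def linf {d : ℕ} (S : Set (Pt d)) (g : Pt d → ℝ) : ℝ :=
  (eLpNorm g ⊤ (volume.restrict S)).toReal

/-- The SUPG form `a_SUPG(u, v)` on the domain moved by `A`, with cells `A '' K`. -/
def aSUPG {d : ℕ} (M : Mesh d) (A : Pt d → Pt d) (δ : Finset (Pt d) → ℝ) (ε : ℝ)
    (b w : Pt d → Pt d) (c u v : Pt d → ℝ) : ℝ :=
  ε * (∫ x in M.moved A, inner ℝ (gradient u x) (gradient v x))
    + (∫ x in M.moved A, inner ℝ (b x) (gradient u x) * v x)
    + (∫ x in M.moved A, c x * u x * v x)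
    + ∑ K ∈ M.cells, δ K * ∫ x in A '' cell K,
        (-ε * Laplacian.laplacian u x + inner ℝ (b x - w x) (gradient u x) + c x * u x)
          * inner ℝ (b x - w x) (gradient v x)

/-- The square of the mesh-dependent norm `|||u|||` on the domain moved by `A`. -/
def tripleSq {d : ℕ} (M : Mesh d) (A : Pt d → Pt d) (δ : Finset (Pt d) → ℝ) (ε μ : ℝ)
    (b w : Pt d → Pt d) (u : Pt d → ℝ) : ℝ :=
  ε * (∫ x in M.moved A, ‖gradient u x‖ ^ 2)
    + (∑ K ∈ M.cells, δ K * ∫ x in A '' cell K, (inner ℝ (b x - w x) (gradient u x)) ^ 2)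
    + μ * l2sq (M.moved A) u

/-- The ALE map at the midpoint of the `n`-th time step. -/
def midMap {d : ℕ} (A : ℕ → Pt d → Pt d) (n : ℕ) : Pt d → Pt d :=
  interp (A n) (A (n + 1)) (1 / 2)

/-- The midpoint `t^{n+1/2}` of the `n`-th time step, where `t^n = n Δt`. -/
def midTime (Δt : ℝ) (n : ℕ) : ℝ := ((n : ℝ) + 1 / 2) * Δt

/-- The mesh velocity of the step from `t^n` to `t^{n+1}`, constant in time on the reference
frame, as an Eulerian field at the midpoint of the step. -/
def meshVel {d : ℕ} (M : Mesh d) (Δt : ℝ) (A : ℕ → Pt d → Pt d) (n : ℕ) : Pt d → Pt d :=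
  push M (midMap A n) (fun Y => Δt⁻¹ • (A (n + 1) Y - A n Y))

/-- The Jacobian of the map `B ∘ A⁻¹` from the domain moved by `A` to the one moved by `B`. -/
def jac {d : ℕ} (M : Mesh d) (A B : Pt d → Pt d) (x : Pt d) : ℝ :=
  |(fderiv ℝ (push M A B) x).det|

/-- `β₁ⁿ`, for `n ≥ 1`: the coefficient of `‖u_hⁿ‖²` caused by the step that ends at `t^n`
(there is no such step for `n = 0`). -/
def betaOne {d : ℕ} (M : Mesh d) (Δt : ℝ) (A : ℕ → Pt d → Pt d) : ℕ → ℝ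
  | 0 => 0
  | n + 1 => 1 / 2 * linf (M.moved (midMap A n)) (diverg (meshVel M Δt A n))
      * linf (M.moved (A (n + 1))) (jac M (A (n + 1)) (midMap A n))

/-- `β₂ⁿ`: the coefficient of `‖u_hⁿ‖²` caused by the step that starts at `t^n`. The last step
starts at `t^N`, so the value is `0` for `n > N`. -/
def betaTwo {d : ℕ} (M : Mesh d) (Δt : ℝ) (A : ℕ → Pt d → Pt d) (N n : ℕ) : ℝ :=
  if n ≤ N then
    1 / 2 * linf (M.moved (midMap A n)) (diverg (meshVel M Δt A n))
      * linf (M.moved (A n)) (jac M (A n) (midMap A n))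
  else 0

/-- One step of the conservative ALE-SUPG scheme with the (midpoint) Crank–Nicolson method, from
`t^n` to `t^{n+1}`. The discrete functions are given by their representatives on the reference
region; `ub` and `vm` are the mean value of `u_hⁿ, u_hⁿ⁺¹` and the test function on the midpoint
domain. -/
def CNStep {d : ℕ} (M : Mesh d) (V : Submodule ℝ (Pt d → ℝ)) (A : ℕ → Pt d → Pt d)
    (δ : ℕ → Finset (Pt d) → ℝ) (Δt ε : ℝ) (b : ℝ → Pt d → Pt d) (c f : ℝ → Pt d → ℝ)
    (u : ℕ → Pt d → ℝ) (n : ℕ) : Prop :=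
  ∀ v ∈ V,
    let Am := midMap A n
    let tm := midTime Δt n
    let w := meshVel M Δt A n
    let ub := push M Am (fun Y => (u (n + 1) Y + u n Y) / 2)
    let vm := push M Am v
    (∫ x in M.moved (A (n + 1)), push M (A (n + 1)) (u (n + 1)) x * push M (A (n + 1)) v x)
      - (∫ x in M.moved (A n), push M (A n) (u n) x * push M (A n) v x)
      + Δt * aSUPG M Am (δ n) ε (b tm) w (c tm) ub vm
      - Δt * (∫ x in M.moved Am, diverg (fun y => ub y • w y) x * vm x)
    = Δt * (∫ x in M.moved Am, f tm x * vm x)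
      + ∑ K ∈ M.cells, δ n K *
          ∫ x in Am '' cell K, Δt * f tm x * inner ℝ (b tm x - w x) (gradient vm x)

end ALESUPG

end

/-! Write u₀, u₁ for the solution at the two ends of a step, s = u₁ + u₀, e = u₁ - u₀. Test the
scheme with the mean s/2 and double it.

Time terms (`time_terms_lower_bound`). By polarization the doubled mass terms equal ‖u₁‖² - ‖u₀‖²,
each norm on its own domain, plus a quarter of the change of ‖s‖² - ‖e‖² between the two domains.
The geometric conservation law turns that change into Δt ∫ (s² - e²) div w on the midpoint domain.
Integration by parts turns the doubled conservative mesh velocity term into Δt/4 ∫ s² div w, so the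
s² contributions cancel exactly. Only -Δt/4 ∫ e² div w survives; e² ≤ 2(u₁² + u₀²) and the change of
domain `l2sq_push_le` bound it by the β terms.

Space terms. `half_tripleSq_le_aSUPG` gives coercivity with constant 1/2, hence a dissipation of Δt
|||s/2|||² = Δt/4 |||s|||². Young's inequality in `load_le` spends half of it on the load, which
leaves Δt/8; if f = 0 nothing is spent. Summation over the steps is `discrete_gronwall`.

Two facts carry the geometry. Finite element functions and mesh velocities are only cellwise smooth,
so `IsALEMap.integral_inner_gradient_mul` integrates by parts globally: u²B extended by zero is
Lipschitz with compact support, and its divergence has integral zero. For d ≤ 2 the conservation law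
is `geometric_conservation`: on each cell the linear parts of the end maps are (1 ± X)L, with L that
of the midpoint map, and det(1 + X) - det(1 - X) = 2 tr X. -/

noncomputable section

namespace ALESUPG

open MeasureTheory Set

/-! ### Affine charts of the moved cells and decomposition of the moved domain. -/

section Geometry

variable {d : ℕ} {M : Mesh d} {A : Pt d → Pt d} {K : Finset (Pt d)}

/-- `A` coincides on `cell K` with the affine bijection `Y ↦ L Y + p`. -/
def IsChart (A : Pt d → Pt d) (K : Finset (Pt d)) (L : Pt d ≃L[ℝ] Pt d) (p : Pt d) : Prop :=
  ∀ Y ∈ cell K, A Y = L Y + p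

lemma isCompact_cell (K : Finset (Pt d)) : IsCompact (cell K) :=
  K.finite_toSet.isCompact_convexHull ℝ

lemma convex_cell (K : Finset (Pt d)) : Convex ℝ (cell K) := convex_convexHull ℝ _

lemma cell_subset_region (hK : K ∈ M.cells) : cell K ⊆ M.region :=
  subset_biUnion_of_mem (u := fun K => cell K) hK

lemma interior_cell_nonempty (hK : K ∈ M.cells) : (interior (cell K)).Nonempty := by
  rw [cell, interior_convexHull_nonempty_iff_affineSpan_eq_top]
  have h := (M.indep K hK).affineSpan_eq_top_iff_card_eq_finrank_add_one
  have h2 := h.2 (by simpa using M.card_eq K hK)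
  simpa using h2

/-- By conformity the intersection is the hull of the common vertices. It lies in a proper affine
subspace, since full span would require d + 1 common vertices and force the cells to coincide. -/
lemma volume_cell_inter_cell {K' : Finset (Pt d)} (hK : K ∈ M.cells) (hK' : K' ∈ M.cells)
    (hne : K ≠ K') : volume (cell K ∩ cell K') = 0 := by
  classical
  rw [cell, cell, M.inter_eq K hK K' hK']
  have hsub : convexHull ℝ ((K : Set (Pt d)) ∩ K') ⊆ affineSpan ℝ ((K : Set (Pt d)) ∩ K') :=
    convexHull_subset_affineSpan _
  refine measure_mono_null hsub (Measure.addHaar_affineSubspace _ _ fun htop => ?_)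
  have hind : AffineIndependent ℝ ((↑) : (K ∩ K' : Finset (Pt d)) → Pt d) :=
    (M.indep K hK).mono (by simp)
  have hr : Set.range ((↑) : (K ∩ K' : Finset (Pt d)) → Pt d) = (K : Set (Pt d)) ∩ K' := by
    rw [Subtype.range_coe_subtype]; ext; simp
  have h := hind.affineSpan_eq_top_iff_card_eq_finrank_add_one.1 (by rw [hr]; exact htop)
  have hcard : (K ∩ K').card = d + 1 := by simpa using h
  have h1 : K ∩ K' = K :=
    Finset.eq_of_subset_of_card_le Finset.inter_subset_left (by rw [hcard, M.card_eq K hK])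
  have h2 : K ∩ K' = K' :=
    Finset.eq_of_subset_of_card_le Finset.inter_subset_right (by rw [hcard, M.card_eq K' hK'])
  exact hne (h1.symm.trans h2)

/-- Moving an interior point of the cell slightly along a kernel vector would not change its image.
This converts injectivity at each intermediate time into invertibility. -/
lemma det_ne_zero_of_injOn {L : Pt d →L[ℝ] Pt d} {p : Pt d} (hK : K ∈ M.cells)
    (hAL : ∀ Y ∈ cell K, A Y = L Y + p) (hinj : InjOn A (cell K)) : L.det ≠ 0 := by
  intro h0
  have hker : LinearMap.ker (L : Pt d →ₗ[ℝ] Pt d) ≠ ⊥ :=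
    (LinearMap.bot_lt_ker_of_det_eq_zero (f := (L : Pt d →ₗ[ℝ] Pt d)) h0).ne'
  obtain ⟨z, hz, hz0⟩ := Submodule.exists_mem_ne_zero_of_ne_bot hker
  obtain ⟨Y, hY⟩ := interior_cell_nonempty hK
  have hcont : ContinuousAt (fun t : ℝ => Y + t • z) 0 := by fun_prop
  have hev : ∀ᶠ t : ℝ in nhds 0, Y + t • z ∈ cell K :=
    hcont.eventually_mem (by simpa using mem_interior_iff_mem_nhds.1 hY)
  obtain ⟨t, ht, ht0⟩ := ((hev.filter_mono nhdsWithin_le_nhds).and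
    (self_mem_nhdsWithin : {0}ᶜ ∈ nhdsWithin (0 : ℝ) {0}ᶜ)).exists
  have hLz : L z = 0 := hz
  have heq : A (Y + t • z) = A Y := by
    rw [hAL _ ht, hAL _ (interior_subset hY)]
    simp [hLz]
  have := hinj ht (interior_subset hY) heq
  have h1 : t • z = 0 := by simpa using this
  rcases smul_eq_zero.1 h1 with h | h
  · exact ht0 h
  · exact hz0 h

/-- The affine map on a cell, as a linear part and a translation. -/
lemma IsALEMap.exists_linear (hA : IsALEMap M A) (hK : K ∈ M.cells) :
    ∃ (L : Pt d →L[ℝ] Pt d) (p : Pt d), ∀ Y ∈ cell K, A Y = L Y + p := by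
  obtain ⟨g, hg⟩ := hA.affine_on K hK
  refine ⟨LinearMap.toContinuousLinearMap g.linear, g 0, fun Y hY => ?_⟩
  rw [hg hY]
  exact congrFun (AffineMap.decomp g) Y

lemma IsALEMap.exists_chart (hA : IsALEMap M A) (hK : K ∈ M.cells) :
    ∃ L p, IsChart A K L p := by
  obtain ⟨L, p, h⟩ := hA.exists_linear hK
  have hdet := det_ne_zero_of_injOn hK h (hA.injOn.mono (cell_subset_region hK))
  exact ⟨L.toContinuousLinearEquivOfDetNeZero hdet, p, h⟩

namespace IsChart

variable {L : Pt d ≃L[ℝ] Pt d} {p : Pt d}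

lemma image_eq (h : IsChart A K L p) : A '' cell K = (fun Y => L Y + p) '' cell K :=
  image_congr h

lemma isCompact (h : IsChart A K L p) : IsCompact (A '' cell K) := by
  rw [h.image_eq]
  exact (isCompact_cell K).image (by fun_prop)

lemma convex (h : IsChart A K L p) : Convex ℝ (A '' cell K) := by
  rw [h.image_eq]
  have := ((convex_cell K).linear_image (L : Pt d →ₗ[ℝ] Pt d)).translate p
  have heq : (fun Y => L Y + p) '' cell K
      = (fun x => p + x) '' ((L : Pt d →ₗ[ℝ] Pt d) '' cell K) := by
    rw [image_image]
    simp [add_comm]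
  rw [heq]
  exact this

lemma measurableSet (h : IsChart A K L p) : MeasurableSet (A '' cell K) :=
  h.isCompact.isClosed.measurableSet

lemma mem_image_iff (h : IsChart A K L p) {x : Pt d} :
    x ∈ A '' cell K ↔ L.symm (x - p) ∈ cell K := by
  rw [h.image_eq]
  constructor
  · rintro ⟨Y, hY, rfl⟩
    simpa using hY
  · intro hx
    exact ⟨_, hx, by simp⟩

/-- The frontier of a convex set is null. In the interior of a cell, derivatives see only the smooth
local representative, so derivative identities hold a.e. there. -/
lemma ae_mem_interior (h : IsChart A K L p) :
    ∀ᵐ x ∂(volume.restrict (A '' cell K)), x ∈ interior (A '' cell K) := by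
  have h0 := h.convex.addHaar_frontier volume
  rw [ae_restrict_iff' h.measurableSet]
  have h1 : ∀ᵐ x ∂(volume : Measure (Pt d)), x ∉ frontier (A '' cell K) :=
    measure_eq_zero_iff_ae_notMem.1 h0
  filter_upwards [h1] with x hx hmem
  by_contra hni
  exact hx ⟨subset_closure hmem, hni⟩

lemma integral_image (h : IsChart A K L p) (g : Pt d → ℝ) :
    ∫ x in A '' cell K, g x
      = |(L : Pt d →L[ℝ] Pt d).det| * ∫ Y in cell K, g (A Y) := by
  have hm : MeasurableSet (cell K) := (isCompact_cell K).isClosed.measurableSet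
  have hinj : InjOn (fun Y => L Y + p) (cell K) := fun x _ y _ hxy => by simpa using hxy
  rw [h.image_eq, integral_image_eq_integral_abs_det_fderiv_smul volume hm
    (f' := fun _ => (L : Pt d →L[ℝ] Pt d)) (fun x _ => ?_) hinj, ← integral_const_mul]
  · refine setIntegral_congr_fun hm fun Y hY => ?_
    simp only [smul_eq_mul]
    rw [h Y hY]
  · exact ((L : Pt d →L[ℝ] Pt d).hasFDerivWithinAt).add_const p

lemma interior_nonempty (h : IsChart A K L p) (hK : K ∈ M.cells) :
    (interior (A '' cell K)).Nonempty := by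
  obtain ⟨Y, hY⟩ := interior_cell_nonempty hK
  rw [mem_interior_iff_mem_nhds] at hY
  refine ⟨L Y + p, mem_interior_iff_mem_nhds.2 ?_⟩
  have hc : ContinuousAt (fun x => L.symm (x - p)) (L Y + p) := by fun_prop
  have := hc.preimage_mem_nhds (t := cell K) (by simpa using hY)
  exact Filter.mem_of_superset this fun x hx => h.mem_image_iff.2 hx

end IsChart

lemma Mesh.moved_eq (M : Mesh d) (A : Pt d → Pt d) :
    M.moved A = ⋃ K ∈ M.cells, A '' cell K := by
  simp [Mesh.moved, Mesh.region, image_iUnion]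

lemma image_cell_subset_moved (hK : K ∈ M.cells) : A '' cell K ⊆ M.moved A :=
  image_mono (cell_subset_region hK)

lemma IsALEMap.isCompact_moved (hA : IsALEMap M A) : IsCompact (M.moved A) := by
  rw [Mesh.moved_eq]
  refine M.cells.isCompact_biUnion fun K hK => ?_
  obtain ⟨L, p, h⟩ := hA.exists_chart hK
  exact h.isCompact

lemma IsALEMap.volume_inter (hA : IsALEMap M A) {K' : Finset (Pt d)} (hK : K ∈ M.cells)
    (hK' : K' ∈ M.cells) (hne : K ≠ K') : volume (A '' cell K ∩ A '' cell K') = 0 := by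
  obtain ⟨L, p, h⟩ := hA.exists_chart hK
  rw [← hA.injOn.image_inter (cell_subset_region hK) (cell_subset_region hK'),
    image_congr (g := fun Y => L Y + p) fun Y hY => h Y hY.1]
  refine addHaar_image_eq_zero_of_differentiableOn_of_addHaar_eq_zero volume ?_
    (volume_cell_inter_cell hK hK' hne)
  exact (L.differentiable.add_const p).differentiableOn

/-- Moved cells overlap only in null sets, so integrals over the moved domain split into sums over
cells. -/
lemma IsALEMap.restrict_moved (hA : IsALEMap M A) :
    (volume.restrict (M.moved A) : Measure (Pt d))
      = ∑ K ∈ M.cells, volume.restrict (A '' cell K) := by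
  have h1 : M.moved A = ⋃ K : M.cells, A '' cell K.1 := by
    rw [Mesh.moved_eq]; exact iUnion_subtype (p := fun K => K ∈ M.cells) (s := fun K => A '' cell K.1) |>.symm
  have hm : ∀ K : M.cells, MeasurableSet (A '' cell K.1) := fun K => by
    obtain ⟨L, p, h⟩ := hA.exists_chart K.2
    exact h.measurableSet
  rw [h1, Measure.restrict_iUnion_ae
    (fun i j hij => hA.volume_inter i.2 j.2 fun h => hij (Subtype.ext h))
    (fun K => (hm K).nullMeasurableSet), Measure.sum_fintype]
  exact Finset.sum_coe_sort M.cells fun K => volume.restrict (A '' cell K)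

lemma IsALEMap.integral_moved (hA : IsALEMap M A) {g : Pt d → ℝ}
    (hg : ∀ K ∈ M.cells, IntegrableOn g (A '' cell K)) :
    ∫ x in M.moved A, g x = ∑ K ∈ M.cells, ∫ x in A '' cell K, g x := by
  rw [hA.restrict_moved]
  exact integral_finsetSum_measure hg

lemma IsALEMap.integrableOn_moved (hA : IsALEMap M A) {g : Pt d → ℝ}
    (hg : ∀ K ∈ M.cells, IntegrableOn g (A '' cell K)) : IntegrableOn g (M.moved A) := by
  rw [IntegrableOn, hA.restrict_moved]
  exact integrable_finsetSum_measure.2 hg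

lemma ae_moved {P : Pt d → Prop}
    (h : ∀ K ∈ M.cells, ∀ᵐ x ∂(volume.restrict (A '' cell K)), P x) :
    ∀ᵐ x ∂(volume.restrict (M.moved A)), P x := by
  rw [Mesh.moved_eq]
  exact (ae_restrict_biUnion_finset_iff _ _ _).2 h

lemma ae_image_cell {P : Pt d → Prop} (hK : K ∈ M.cells)
    (h : ∀ᵐ x ∂(volume.restrict (M.moved A)), P x) :
    ∀ᵐ x ∂(volume.restrict (A '' cell K)), P x :=
  ae_restrict_of_ae_restrict_of_subset (image_cell_subset_moved hK) h

lemma IsALEMap.push_apply (hA : IsALEMap M A) {F : Type*} (v : Pt d → F) {Y : Pt d}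
    (hY : Y ∈ M.region) : push M A v (A Y) = v Y := by
  rw [push, hA.injOn.leftInvOn_invFunOn hY]

lemma IsALEMap.push_eq (hA : IsALEMap M A) (hK : K ∈ M.cells) {L : Pt d ≃L[ℝ] Pt d} {p : Pt d}
    (h : IsChart A K L p) {F : Type*} (v : Pt d → F) {x : Pt d} (hx : x ∈ A '' cell K) :
    push M A v x = v (L.symm (x - p)) := by
  obtain ⟨Y, hY, rfl⟩ := hx
  rw [hA.push_apply v (cell_subset_region hK hY), h Y hY]
  simp

end Geometry

/-! ### Gluing Lipschitz bounds along a finite closed cover. -/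

section Gluing

/-- Jump from a to the last point m of [a, b] in the piece that contains a. That piece is not needed
beyond m, so induction on the number of pieces handles [m, b]. -/
lemma dist_le_of_Icc_subset_iUnion {ι F : Type*} [DecidableEq ι] [PseudoMetricSpace F]
    {g : ℝ → F} {C : ℝ} {T : ι → Set ℝ} (hT : ∀ i, IsClosed (T i))
    (hg : ∀ i, ∀ x ∈ T i, ∀ y ∈ T i, dist (g x) (g y) ≤ C * dist x y) (s : Finset ι) :
    ∀ a b : ℝ, a ≤ b → Icc a b ⊆ ⋃ i ∈ s, T i → dist (g a) (g b) ≤ C * (b - a) := by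
  induction s using Finset.strongInduction with
  | H s ih =>
    intro a b hab hcov
    obtain ⟨i, his, hai⟩ : ∃ i ∈ s, a ∈ T i := by simpa using hcov (left_mem_Icc.2 hab)
    have hcomp : IsCompact (T i ∩ Icc a b) := isCompact_Icc.inter_left (hT i)
    have hm := hcomp.sSup_mem ⟨a, hai, left_mem_Icc.2 hab⟩
    set m := sSup (T i ∩ Icc a b) with hmdef
    have h1 : dist (g a) (g m) ≤ C * (m - a) := by
      have := hg i a hai m hm.1
      rwa [dist_comm a m, Real.dist_eq, abs_of_nonneg (sub_nonneg.2 hm.2.1)] at this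
    rcases eq_or_lt_of_le hm.2.2 with hmb | hmb
    · rwa [hmb] at h1
    · have hcov' : Icc m b ⊆ ⋃ j ∈ s.erase i, T j := by
        have hcl : IsClosed (⋃ j ∈ s.erase i, T j) :=
          (s.erase i).finite_toSet.isClosed_biUnion fun j _ => hT j
        rw [← closure_Ioc hmb.ne]
        refine hcl.closure_subset_iff.2 fun x hx => ?_
        obtain ⟨j, hjs, hxj⟩ : ∃ j ∈ s, x ∈ T j := by
          simpa using hcov ⟨hm.2.1.trans hx.1.le, hx.2⟩
        have hji : j ≠ i := by
          rintro rfl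
          exact absurd (le_csSup hcomp.bddAbove ⟨hxj, hm.2.1.trans hx.1.le, hx.2⟩)
            (not_le.2 hx.1)
        simp only [mem_iUnion]
        exact ⟨j, Finset.mem_erase.2 ⟨hji, hjs⟩, hxj⟩
      have h2 := ih _ (Finset.erase_ssubset his) m b hmb.le hcov'
      linarith [dist_triangle (g a) (g m) (g b)]

/-- A function that is Lipschitz on each of finitely many closed sets covering the space is
Lipschitz. -/
lemma exists_lipschitzWith_of_finite_cover {ι E F : Type*} [NormedAddCommGroup E]
    [NormedSpace ℝ E] [PseudoMetricSpace F] {f : E → F} (s : Finset ι) {S : ι → Set E}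
    (hS : ∀ i ∈ s, IsClosed (S i)) (hcov : ∀ x, ∃ i ∈ s, x ∈ S i)
    (hf : ∀ i ∈ s, ∃ C, LipschitzOnWith C f (S i)) : ∃ C, LipschitzWith C f := by
  classical
  have hf' : ∀ i : s, ∃ C, LipschitzOnWith C f (S i) := fun i => hf i i.2
  choose C hC using hf'
  refine ⟨∑ i, C i, LipschitzWith.of_dist_le_mul fun x y => ?_⟩
  have hline : Continuous fun t : ℝ => x + t • (y - x) := by fun_prop
  have key := dist_le_of_Icc_subset_iUnion (g := fun t : ℝ => f (x + t • (y - x)))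
    (C := ((∑ i, C i : NNReal) : ℝ) * dist x y)
    (T := fun i : s => (fun t : ℝ => x + t • (y - x)) ⁻¹' S i)
    (fun i => (hS i i.2).preimage hline) (fun i t ht t' ht' => ?_) Finset.univ 0 1 zero_le_one
    (fun t _ => ?_)
  · simpa using key
  · refine ((hC i).dist_le_mul _ ht _ ht').trans ?_
    have h1 : dist (x + t • (y - x)) (x + t' • (y - x)) = dist x y * dist t t' := by
      rw [dist_add_left, dist_eq_norm, ← sub_smul, norm_smul, dist_comm x y, dist_eq_norm y x,
        Real.dist_eq, Real.norm_eq_abs, mul_comm]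
    rw [h1, mul_assoc]
    gcongr
    exact_mod_cast Finset.single_le_sum (f := C) (fun _ _ => zero_le) (Finset.mem_univ i)
  · obtain ⟨i, hi, hx⟩ := hcov (x + t • (y - x))
    simp only [mem_iUnion]
    exact ⟨⟨i, hi⟩, Finset.mem_univ _, hx⟩

lemma exists_lipschitzOnWith_smul {E F : Type*} [PseudoMetricSpace E] [NormedAddCommGroup F]
    [NormedSpace ℝ F] {T : Set E} (hT : IsCompact T) {ψ : E → ℝ} {B : E → F} {C D : NNReal}
    (hψ : LipschitzOnWith C ψ T) (hB : LipschitzOnWith D B T) :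
    ∃ C', LipschitzOnWith C' (fun x => ψ x • B x) T := by
  obtain ⟨a, ha⟩ := hT.exists_bound_of_continuousOn hψ.continuousOn
  obtain ⟨c, hc⟩ := hT.exists_bound_of_continuousOn hB.continuousOn
  refine ⟨(a * D + C * c).toNNReal, LipschitzOnWith.of_dist_le_mul fun x hx y hy => ?_⟩
  have h1 := hψ.dist_le_mul x hx y hy
  have h2 := hB.dist_le_mul x hx y hy
  have ha0 : 0 ≤ a := (norm_nonneg _).trans (ha x hx)
  have hc0 : 0 ≤ c := (norm_nonneg _).trans (hc x hx)
  rw [Real.coe_toNNReal _ (by positivity), dist_eq_norm]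
  have h3 : ψ x • B x - ψ y • B y = ψ x • (B x - B y) + (ψ x - ψ y) • B y := by
    rw [smul_sub, sub_smul]; abel
  rw [dist_eq_norm] at h1 h2
  calc ‖ψ x • B x - ψ y • B y‖ ≤ ‖ψ x‖ * ‖B x - B y‖ + ‖ψ x - ψ y‖ * ‖B y‖ := by
        rw [h3, ← norm_smul, ← norm_smul]; exact norm_add_le _ _
    _ ≤ a * (D * dist x y) + C * dist x y * c := by
        gcongr
        · exact ha x hx
        · exact hc y hy
    _ = _ := by ring

end Gluing

/-! ### The divergence theorem for Lipschitz fields and product rules. -/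

section Divergence

variable {d : ℕ}

/-- Integration by parts against the constant 1, whose derivative vanishes; by Rademacher the line
derivative is a.e. the Fréchet derivative. -/
lemma integral_fderiv_eq_zero_of_lipschitz {f : Pt d → ℝ} {C : NNReal} (hf : LipschitzWith C f)
    (hs : HasCompactSupport f) (e : Pt d) : ∫ x, fderiv ℝ f x e = 0 := by
  have h := LipschitzWith.integral_lineDeriv_mul_eq (μ := volume)
    (LipschitzWith.const (1 : ℝ) : LipschitzWith 0 fun _ : Pt d => (1 : ℝ)) hf hs (-e)
  have h0 : ∀ x : Pt d, lineDeriv ℝ (fun _ : Pt d => (1 : ℝ)) x (-e) = 0 := fun x => by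
    simp [lineDeriv]
  simp only [h0, zero_mul, integral_zero, neg_neg, mul_one] at h
  rw [h]
  refine integral_congr_ae ?_
  filter_upwards [hf.ae_differentiableAt (μ := volume)] with x hx
  exact hx.lineDeriv_eq_fderiv.symm

lemma integrable_fderiv_of_lipschitz {f : Pt d → ℝ} {C : NNReal} (hf : LipschitzWith C f)
    (hs : HasCompactSupport f) (e : Pt d) : Integrable fun x => fderiv ℝ f x e := by
  have hmeas : Measurable fun x => fderiv ℝ f x e := measurable_fderiv_apply_const ℝ f e
  have hsupp : ∀ x, x ∉ tsupport f → fderiv ℝ f x e = 0 := fun x hx => by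
    rw [fderiv_of_notMem_tsupport ℝ hx]; rfl
  have hon : IntegrableOn (fun x => fderiv ℝ f x e) (tsupport f) := by
    refine Measure.integrableOn_of_bounded (M := C * ‖e‖) hs.isCompact.measure_lt_top.ne
      hmeas.aestronglyMeasurable (ae_of_all _ fun x => ?_)
    exact (ContinuousLinearMap.le_opNorm _ _).trans
      (by gcongr; exact norm_fderiv_le_of_lipschitz ℝ hf)
  exact hon.integrable_of_forall_notMem_eq_zero hsupp

lemma diverg_eq_sum_fderiv {w : Pt d → Pt d} {x : Pt d} (hw : DifferentiableAt ℝ w x) :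
    diverg w x = ∑ i, fderiv ℝ (fun y => w y i) x (EuclideanSpace.single i 1) := by
  refine Finset.sum_congr rfl fun i _ => ?_
  have h := ((EuclideanSpace.proj i : Pt d →L[ℝ] ℝ).hasFDerivAt.comp x
    hw.hasFDerivAt).fderiv
  have h2 : (fun y => w y i) = (EuclideanSpace.proj i : Pt d →L[ℝ] ℝ) ∘ w :=
    rfl
  rw [h2, h]
  rfl

/-- The divergence theorem for compactly supported Lipschitz fields. -/
lemma integral_diverg_eq_zero {w : Pt d → Pt d} {C : NNReal} (hw : LipschitzWith C w)
    (hs : HasCompactSupport w) : ∫ x, diverg w x = 0 := by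
  have hLip : ∀ i, LipschitzWith C fun y => w y i := fun i =>
    LipschitzWith.of_dist_le_mul fun x y => by
      refine le_trans ?_ (hw.dist_le_mul x y)
      rw [dist_eq_norm, dist_eq_norm]
      exact PiLp.norm_apply_le (w x - w y) i
  have hsi : ∀ i, HasCompactSupport fun y => w y i := fun i =>
    hs.comp_left (g := fun z : Pt d => z i) rfl
  have h1 : ∫ x, diverg w x
      = ∫ x, ∑ i, fderiv ℝ (fun y => w y i) x (EuclideanSpace.single i 1) := by
    refine integral_congr_ae ?_
    filter_upwards [hw.ae_differentiableAt (μ := volume)] with x hx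
    exact diverg_eq_sum_fderiv hx
  rw [h1, integral_finsetSum _ fun i _ => integrable_fderiv_of_lipschitz (hLip i) (hsi i) _]
  exact Finset.sum_eq_zero fun i _ => integral_fderiv_eq_zero_of_lipschitz (hLip i) (hsi i) _

lemma diverg_congr {w w' : Pt d → Pt d} {x : Pt d} (h : w =ᶠ[nhds x] w') :
    diverg w x = diverg w' x := by
  simp only [diverg, h.fderiv_eq]

lemma gradient_congr {u u' : Pt d → ℝ} {x : Pt d} (h : u =ᶠ[nhds x] u') :
    gradient u x = gradient u' x := by
  simp only [gradient, h.fderiv_eq]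

lemma diverg_smul {ψ : Pt d → ℝ} {B : Pt d → Pt d} {x : Pt d} (hψ : DifferentiableAt ℝ ψ x)
    (hB : DifferentiableAt ℝ B x) :
    diverg (fun y => ψ y • B y) x = ψ x * diverg B x + inner ℝ (B x) (gradient ψ x) := by
  have h1 : inner ℝ (B x) (gradient ψ x) = fderiv ℝ ψ x (B x) := by
    rw [inner_gradient_right]; simp
  have h2 : B x = ∑ i, B x i • EuclideanSpace.single i (1 : ℝ) := by
    have := (EuclideanSpace.basisFun (Fin d) ℝ).sum_repr (B x)
    simpa using this.symm
  have h3 : fderiv ℝ ψ x (B x) = ∑ i, fderiv ℝ ψ x (EuclideanSpace.single i 1) * B x i := by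
    conv_lhs => rw [h2]
    simp [map_sum, mul_comm]
  rw [h1, h3, diverg, diverg, Finset.mul_sum, ← Finset.sum_add_distrib]
  refine Finset.sum_congr rfl fun i _ => ?_
  rw [fderiv_fun_smul hψ hB]
  simp

lemma gradient_sq {ψ : Pt d → ℝ} {x : Pt d} (hψ : DifferentiableAt ℝ ψ x) :
    gradient (fun y => ψ y ^ 2) x = (2 * ψ x) • gradient ψ x := by
  simp only [gradient]
  rw [fderiv_fun_pow 2 hψ]
  simp

lemma measurable_diverg (w : Pt d → Pt d) : Measurable (diverg w) := by
  unfold diverg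
  refine Finset.measurable_sum _ fun i _ => ?_
  exact (EuclideanSpace.proj i : Pt d →L[ℝ] ℝ).continuous.measurable.comp
    (measurable_fderiv_apply_const ℝ w _)

lemma abs_diverg_le {w : Pt d → Pt d} {x : Pt d} {s : Set (Pt d)} (hs : s ∈ nhds x)
    {C : NNReal} (hw : LipschitzOnWith C w s) : |diverg w x| ≤ d * C := by
  have h := norm_fderiv_le_of_lipschitzOn ℝ hs hw
  refine (Finset.abs_sum_le_sum_abs _ _).trans ?_
  have : ∀ i ∈ Finset.univ, |(fderiv ℝ w x (EuclideanSpace.single i 1)) i| ≤ (C : ℝ) := by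
    intro i _
    refine (PiLp.norm_apply_le (fderiv ℝ w x (EuclideanSpace.single i 1)) i).trans ?_
    refine (ContinuousLinearMap.le_opNorm _ _).trans ?_
    simpa using h
  refine (Finset.sum_le_card_nsmul _ _ _ this).trans ?_
  simp

end Divergence

/-! ### Essential bounds on a single cell. -/

section CellRegularity

variable {d : ℕ} {T : Set (Pt d)}

lemma memLp_top_of_continuousOn {F : Type*} [NormedAddCommGroup F]
    {g : Pt d → F} (hT : IsCompact T) (hg : ContinuousOn g T) :
    MemLp g ⊤ (volume.restrict T) := by
  obtain ⟨C, hC⟩ := hT.exists_bound_of_continuousOn hg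
  refine memLp_top_of_bound
    (hg.aestronglyMeasurable_of_isCompact hT hT.isClosed.measurableSet) C ?_
  exact (ae_restrict_iff' hT.isClosed.measurableSet).2 (ae_of_all _ hC)

lemma memLp_top_mul {g h : Pt d → ℝ} {ν : Measure (Pt d)} (hg : MemLp g ⊤ ν)
    (hh : MemLp h ⊤ ν) : MemLp (fun x => g x * h x) ⊤ ν := hh.mul hg

lemma memLp_top_inner {g h : Pt d → Pt d} {ν : Measure (Pt d)} (hg : MemLp g ⊤ ν)
    (hh : MemLp h ⊤ ν) : MemLp (fun x => inner ℝ (g x) (h x)) ⊤ ν := by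
  refine MemLp.of_bilin (fun a b => inner ℝ a b) 1 hg hh
    (hg.aestronglyMeasurable.inner hh.aestronglyMeasurable) (ae_of_all _ fun x => ?_)
  simpa using nnnorm_inner_le_nnnorm (𝕜 := ℝ) (g x) (h x)

lemma eventuallyEq_of_mem_interior {F : Type*} {g h : Pt d → F} (hgh : EqOn g h T) {x : Pt d}
    (hx : x ∈ interior T) : g =ᶠ[nhds x] h :=
  Filter.mem_of_superset (mem_interior_iff_mem_nhds.1 hx) hgh

lemma ContDiff.continuous_gradient {φ : Pt d → ℝ} (hφ : ContDiff ℝ 2 φ) :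
    Continuous (gradient φ) :=
  (InnerProductSpace.toDual ℝ (Pt d)).symm.continuous.comp (hφ.continuous_fderiv (by norm_num))

lemma ContDiff.continuous_laplacian {φ : Pt d → ℝ} (hφ : ContDiff ℝ 2 φ) :
    Continuous (Laplacian.laplacian φ) := by
  rw [InnerProductSpace.laplacian_eq_iteratedFDeriv_stdOrthonormalBasis]
  have h := hφ.continuous_iteratedFDeriv (m := 2) le_rfl
  fun_prop

lemma memLp_top_gradient (hT : IsCompact T)
    (hI : ∀ᵐ x ∂(volume.restrict T), x ∈ interior T) {u φ : Pt d → ℝ} (hφ : ContDiff ℝ 2 φ)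
    (h : EqOn u φ T) : MemLp (gradient u) ⊤ (volume.restrict T) := by
  refine (memLp_congr_ae ?_).2
    (memLp_top_of_continuousOn hT (ContDiff.continuous_gradient hφ).continuousOn)
  filter_upwards [hI] with x hx
  exact gradient_congr (eventuallyEq_of_mem_interior h hx)

lemma memLp_top_laplacian (hT : IsCompact T)
    (hI : ∀ᵐ x ∂(volume.restrict T), x ∈ interior T) {u φ : Pt d → ℝ} (hφ : ContDiff ℝ 2 φ)
    (h : EqOn u φ T) : MemLp (Laplacian.laplacian u) ⊤ (volume.restrict T) := by
  refine (memLp_congr_ae ?_).2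
    (memLp_top_of_continuousOn hT (ContDiff.continuous_laplacian hφ).continuousOn)
  filter_upwards [hI] with x hx
  exact (InnerProductSpace.laplacian_congr_nhds (eventuallyEq_of_mem_interior h hx)).eq_of_nhds

lemma memLp_top_of_eqOn (hT : IsCompact T) {u φ : Pt d → ℝ} (hφ : ContDiff ℝ 2 φ)
    (h : EqOn u φ T) : MemLp u ⊤ (volume.restrict T) :=
  memLp_top_of_continuousOn hT (hφ.continuous.continuousOn.congr h)

lemma memLp_top_diverg {B : Pt d → Pt d} {C : NNReal}
    (hI : ∀ᵐ x ∂(volume.restrict T), x ∈ interior T) (hB : LipschitzOnWith C B T) :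
    MemLp (diverg B) ⊤ (volume.restrict T) := by
  refine memLp_top_of_bound (measurable_diverg B).aestronglyMeasurable (d * C) ?_
  filter_upwards [hI] with x hx
  exact abs_diverg_le (mem_interior_iff_mem_nhds.1 hx) hB

lemma ae_differentiableAt_of_lipschitzOnWith {B : Pt d → Pt d} {C : NNReal}
    (hT : MeasurableSet T) (hI : ∀ᵐ x ∂(volume.restrict T), x ∈ interior T)
    (hB : LipschitzOnWith C B T) : ∀ᵐ x ∂(volume.restrict T), DifferentiableAt ℝ B x := by
  filter_upwards [hI, hB.ae_differentiableWithinAt hT] with x hx hdx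
  exact hdx.differentiableAt (mem_interior_iff_mem_nhds.1 hx)

lemma integrableOn_of_memLp_top {g : Pt d → ℝ} (hT : IsCompact T)
    (hg : MemLp g ⊤ (volume.restrict T)) : IntegrableOn g T := by
  have : IsFiniteMeasure (volume.restrict T) := ⟨by simpa using hT.measure_lt_top⟩
  exact hg.integrable le_top

/-- An a priori bound is required because `toReal` sends an infinite norm to 0. No measurability of
g is needed. -/
lemma ae_abs_le_linf {S : Set (Pt d)} {g : Pt d → ℝ} {C : ℝ}
    (hg : ∀ᵐ x ∂(volume.restrict S), |g x| ≤ C) :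
    ∀ᵐ x ∂(volume.restrict S), |g x| ≤ linf S g := by
  have hfin : eLpNorm g ⊤ (volume.restrict S) ≠ ⊤ := by
    rw [eLpNorm_exponent_top]
    exact (eLpNormEssSup_lt_top_of_ae_bound (by simpa using hg)).ne
  filter_upwards [ae_le_eLpNormEssSup (f := g) (μ := volume.restrict S)] with x hx
  rw [← eLpNorm_exponent_top] at hx
  have := ENNReal.toReal_mono hfin hx
  simpa [linf] using this

lemma ae_abs_le_linf_of_memLp {S : Set (Pt d)} {g : Pt d → ℝ}
    (hg : MemLp g ⊤ (volume.restrict S)) :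
    ∀ᵐ x ∂(volume.restrict S), |g x| ≤ linf S g := by
  filter_upwards [ae_le_eLpNormEssSup (f := g) (μ := volume.restrict S)] with x hx
  rw [← eLpNorm_exponent_top] at hx
  have := ENNReal.toReal_mono hg.2.ne hx
  simpa [linf] using this

lemma linf_nonneg (S : Set (Pt d)) (g : Pt d → ℝ) : 0 ≤ linf S g := ENNReal.toReal_nonneg

lemma l2sq_nonneg (S : Set (Pt d)) (g : Pt d → ℝ) : 0 ≤ l2sq S g :=
  integral_nonneg fun _ => sq_nonneg _

end CellRegularity

/-! ### Regularity of Eulerian finite element functions and integration by parts. -/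

section PushRegularity

variable {d : ℕ} {M : Mesh d} {A : Pt d → Pt d} {K : Finset (Pt d)} {v : Pt d → ℝ}

lemma IsALEMap.exists_contDiff_eqOn (hA : IsALEMap M A) (hv : IsConforming M v)
    (hK : K ∈ M.cells) : ∃ φ, ContDiff ℝ 2 φ ∧ EqOn (push M A v) φ (A '' cell K) := by
  obtain ⟨L, p, h⟩ := hA.exists_chart hK
  obtain ⟨g, hg, hvg⟩ := hv.smooth_on K hK
  refine ⟨fun x => g (L.symm (x - p)), ?_, fun x hx => ?_⟩
  · exact hg.comp (L.symm.contDiff.comp (contDiff_id.sub contDiff_const))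
  · rw [hA.push_eq hK h v hx]
    exact hvg (h.mem_image_iff.1 hx)

lemma IsALEMap.isCompact_image (hA : IsALEMap M A) (hK : K ∈ M.cells) :
    IsCompact (A '' cell K) := by
  obtain ⟨L, p, h⟩ := hA.exists_chart hK
  exact h.isCompact

lemma IsALEMap.measurableSet_image (hA : IsALEMap M A) (hK : K ∈ M.cells) :
    MeasurableSet (A '' cell K) := (hA.isCompact_image hK).isClosed.measurableSet

lemma IsALEMap.convex_image (hA : IsALEMap M A) (hK : K ∈ M.cells) :
    Convex ℝ (A '' cell K) := by
  obtain ⟨L, p, h⟩ := hA.exists_chart hK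
  exact h.convex

lemma IsALEMap.ae_mem_interior (hA : IsALEMap M A) (hK : K ∈ M.cells) :
    ∀ᵐ x ∂(volume.restrict (A '' cell K)), x ∈ interior (A '' cell K) := by
  obtain ⟨L, p, h⟩ := hA.exists_chart hK
  exact h.ae_mem_interior

lemma IsALEMap.memLp_push (hA : IsALEMap M A) (hv : IsConforming M v) (hK : K ∈ M.cells) :
    MemLp (push M A v) ⊤ (volume.restrict (A '' cell K)) := by
  obtain ⟨φ, hφ, h⟩ := hA.exists_contDiff_eqOn hv hK
  exact memLp_top_of_eqOn (hA.isCompact_image hK) hφ h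

lemma IsALEMap.memLp_gradient (hA : IsALEMap M A) (hv : IsConforming M v) (hK : K ∈ M.cells) :
    MemLp (gradient (push M A v)) ⊤ (volume.restrict (A '' cell K)) := by
  obtain ⟨φ, hφ, h⟩ := hA.exists_contDiff_eqOn hv hK
  exact memLp_top_gradient (hA.isCompact_image hK) (hA.ae_mem_interior hK) hφ h

lemma IsALEMap.memLp_laplacian (hA : IsALEMap M A) (hv : IsConforming M v) (hK : K ∈ M.cells) :
    MemLp (Laplacian.laplacian (push M A v)) ⊤ (volume.restrict (A '' cell K)) := by
  obtain ⟨φ, hφ, h⟩ := hA.exists_contDiff_eqOn hv hK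
  exact memLp_top_laplacian (hA.isCompact_image hK) (hA.ae_mem_interior hK) hφ h

lemma IsALEMap.ae_differentiableAt_push (hA : IsALEMap M A) (hv : IsConforming M v)
    (hK : K ∈ M.cells) :
    ∀ᵐ x ∂(volume.restrict (A '' cell K)), DifferentiableAt ℝ (push M A v) x := by
  obtain ⟨φ, hφ, h⟩ := hA.exists_contDiff_eqOn hv hK
  filter_upwards [hA.ae_mem_interior hK] with x hx
  exact ((hφ.differentiable (by norm_num)) x).congr_of_eventuallyEq
    (eventuallyEq_of_mem_interior h hx)

lemma IsALEMap.push_eq_zero (hA : IsALEMap M A) (hv : IsConforming M v) {x : Pt d}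
    (hx : x ∈ M.moved A) (hx' : x ∉ A '' interior M.region) : push M A v x = 0 := by
  obtain ⟨Y, hY, rfl⟩ := hx
  rw [hA.push_apply v hY]
  exact hv.zero_outside Y fun h => hx' ⟨Y, h, rfl⟩

/-- `u² B`, extended by zero, is Lipschitz if `u` is a finite element function and the field `B` is
Lipschitz on every closed cell. -/
lemma IsALEMap.exists_lipschitzWith_indicator (hA : IsALEMap M A) (hv : IsConforming M v)
    {B : Pt d → Pt d} (hB : ∀ K ∈ M.cells, ∃ C, LipschitzOnWith C B (A '' cell K)) :
    ∃ C, LipschitzWith C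
      ((M.moved A).indicator fun x => (push M A v x) ^ 2 • B x) := by
  classical
  -- The index `none` stands for the complement of the moved open domain. It is closed because the
  -- ALE map sends the reference domain to an open set, and the extended field vanishes on it.
  refine exists_lipschitzWith_of_finite_cover (Finset.insertNone M.cells)
    (S := fun o => o.elim (A '' interior M.region)ᶜ fun K => A '' cell K) ?_ ?_ ?_
  · rintro (_ | K) hK
    · exact hA.isOpen_image.isClosed_compl
    · exact (hA.isCompact_image (by simpa using hK)).isClosed
  · intro x
    by_cases hx : x ∈ M.moved A
    · rw [Mesh.moved_eq] at hx
      obtain ⟨K, hK, hxK⟩ : ∃ K ∈ M.cells, x ∈ A '' cell K := by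
        simpa only [mem_iUnion, exists_prop] using hx
      exact ⟨some K, by simpa using hK, hxK⟩
    · refine ⟨none, by simp, fun h => hx ?_⟩
      exact image_mono interior_subset h
  · rintro (_ | K) hK
    · refine ⟨0, LipschitzOnWith.of_dist_le_mul ?_⟩
      have h0 : ∀ x ∈ (A '' interior M.region)ᶜ,
          (M.moved A).indicator (fun x => (push M A v x) ^ 2 • B x) x = 0 := fun x hx => by
        by_cases hxm : x ∈ M.moved A
        · simp [indicator_of_mem hxm, hA.push_eq_zero hv hxm hx]
        · simp [indicator_of_notMem hxm]
      intro x hx y hy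
      rw [h0 x hx, h0 y hy]
      simp
    · have hK' : K ∈ M.cells := by simpa using hK
      obtain ⟨φ, hφ, h⟩ := hA.exists_contDiff_eqOn hv hK'
      obtain ⟨D, hD⟩ := hB K hK'
      obtain ⟨C, hC⟩ := (hφ.pow 2).contDiffOn.exists_lipschitzOnWith (s := A '' cell K)
        (by norm_num) (hA.convex_image hK') (hA.isCompact_image hK')
      obtain ⟨C', hC'⟩ := exists_lipschitzOnWith_smul (hA.isCompact_image hK') hC hD
      refine ⟨C', LipschitzOnWith.of_dist_le_mul fun x hx y hy => ?_⟩
      have hx' : x ∈ A '' cell K := hx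
      have hy' : y ∈ A '' cell K := hy
      rw [indicator_of_mem (image_cell_subset_moved hK' hx'),
        indicator_of_mem (image_cell_subset_moved hK' hy'), h hx', h hy']
      exact hC'.dist_le_mul x hx' y hy'

lemma memLp_top_of_lipschitzOnWith {T : Set (Pt d)} (hT : IsCompact T) {B : Pt d → Pt d}
    {C : NNReal} (hB : LipschitzOnWith C B T) : MemLp B ⊤ (volume.restrict T) :=
  memLp_top_of_continuousOn hT hB.continuousOn

/-- Integration by parts for `(B · ∇u, u)`, where `u` vanishes on the boundary. -/
lemma IsALEMap.integral_inner_gradient_mul (hA : IsALEMap M A) (hv : IsConforming M v)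
    {B : Pt d → Pt d} (hB : ∀ K ∈ M.cells, ∃ C, LipschitzOnWith C B (A '' cell K)) :
    2 * ∫ x in M.moved A, inner ℝ (B x) (gradient (push M A v) x) * push M A v x
      = - ∫ x in M.moved A, diverg B x * (push M A v x) ^ 2 := by
  set u := push M A v with hu
  obtain ⟨C, hC⟩ := hA.exists_lipschitzWith_indicator hv hB
  set Φ := (M.moved A).indicator fun x => (push M A v x) ^ 2 • B x with hΦ
  have hcl : IsClosed (M.moved A) := hA.isCompact_moved.isClosed
  have hsupp : HasCompactSupport Φ :=
    HasCompactSupport.intro hA.isCompact_moved fun x hx => indicator_of_notMem hx _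
  have h0 := integral_diverg_eq_zero hC hsupp
  have h1 : ∀ x, x ∉ M.moved A → diverg Φ x = 0 := fun x hx => by
    have hev : Φ =ᶠ[nhds x] fun _ => 0 :=
      Filter.mem_of_superset (hcl.isOpen_compl.mem_nhds hx) fun y hy => indicator_of_notMem hy _
    rw [diverg_congr hev]
    simp [diverg]
  rw [← setIntegral_eq_integral_of_forall_compl_eq_zero h1] at h0
  have h2 : ∀ᵐ x ∂(volume.restrict (M.moved A)), diverg Φ x
      = diverg B x * u x ^ 2 + 2 * (inner ℝ (B x) (gradient u x) * u x) := by
    refine ae_moved fun K hK => ?_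
    obtain ⟨D, hD⟩ := hB K hK
    filter_upwards [hA.ae_mem_interior hK, hA.ae_differentiableAt_push hv hK,
      ae_differentiableAt_of_lipschitzOnWith (hA.measurableSet_image hK) (hA.ae_mem_interior hK)
        hD] with x hx hux hBx
    have hev : Φ =ᶠ[nhds x] fun y => (u y) ^ 2 • B y :=
      eventuallyEq_of_mem_interior (T := A '' cell K)
        (fun y hy => indicator_of_mem (image_cell_subset_moved hK hy) _) hx
    rw [diverg_congr hev, diverg_smul (ψ := fun y => u y ^ 2) (hux.pow 2) hBx, gradient_sq hux, inner_smul_right]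
    ring
  have hi1 : IntegrableOn (fun x => diverg B x * u x ^ 2) (M.moved A) :=
    hA.integrableOn_moved fun K hK => by
      obtain ⟨D, hD⟩ := hB K hK
      have hu' := hA.memLp_push hv hK
      simp only [pow_two]
      exact integrableOn_of_memLp_top (hA.isCompact_image hK)
        (memLp_top_mul (memLp_top_diverg (hA.ae_mem_interior hK) hD) (memLp_top_mul hu' hu'))
  have hi2 : IntegrableOn (fun x => inner ℝ (B x) (gradient u x) * u x) (M.moved A) :=
    hA.integrableOn_moved fun K hK => by
      obtain ⟨D, hD⟩ := hB K hK
      exact integrableOn_of_memLp_top (hA.isCompact_image hK)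
        (memLp_top_mul (memLp_top_inner
          (memLp_top_of_lipschitzOnWith (hA.isCompact_image hK) hD)
          (hA.memLp_gradient hv hK)) (hA.memLp_push hv hK))
  rw [integral_congr_ae h2, integral_add hi1 (hi2.const_mul 2), integral_const_mul] at h0
  linarith

end PushRegularity

/-! ### Determinants of perturbations of the identity. -/

section Determinant

/-- The even-degree terms in X cancel and the linear ones give the trace. For d = 3 the cubic term 2
det X would remain, hence d ≤ 2. -/
lemma _root_.Matrix.det_one_add_sub_det_one_sub {d : ℕ} (hd : d ≤ 2)
    (X : Matrix (Fin d) (Fin d) ℝ) : (1 + X).det - (1 - X).det = 2 * X.trace := by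
  interval_cases d
  · simp [Matrix.trace]
  · simp [Matrix.trace]; ring
  · simp [Matrix.det_fin_two, Matrix.trace_fin_two]; ring

lemma _root_.LinearMap.det_one_add_sub_det_one_sub {d : ℕ} (hd : d ≤ 2) (X : Pt d →ₗ[ℝ] Pt d) :
    LinearMap.det (1 + X) - LinearMap.det (1 - X) = 2 * LinearMap.trace ℝ _ X := by
  have b := (EuclideanSpace.basisFun (Fin d) ℝ).toBasis
  rw [← LinearMap.det_toMatrix b, ← LinearMap.det_toMatrix b,
    LinearMap.trace_eq_matrix_trace ℝ b, map_add, map_sub, LinearMap.toMatrix_one,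
    Matrix.det_one_add_sub_det_one_sub hd]

variable {E : Type*} [NormedAddCommGroup E] [NormedSpace ℝ E]

/-- The determinant is 1 at s = 0 and, by the intermediate value theorem, cannot change sign without
a zero. This removes the absolute values from the Jacobians. -/
lemma det_one_add_smul_pos {X : E →L[ℝ] E}
    (h : ∀ s ∈ Icc (-1 : ℝ) 1, (1 + s • X).det ≠ 0) {s : ℝ} (hs : s ∈ Icc (-1 : ℝ) 1) :
    0 < (1 + s • X).det := by
  by_contra hneg
  have hc : Continuous fun s : ℝ => (1 + s • X).det :=
    ContinuousLinearMap.continuous_det.comp (by fun_prop)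
  have h0 : (1 + (0 : ℝ) • X).det = 1 := by
    simp [ContinuousLinearMap.det]
  have hmem : (0 : ℝ) ∈ uIcc ((1 + (0 : ℝ) • X).det) ((1 + s • X).det) := by
    rw [h0, mem_uIcc]
    right
    exact ⟨not_lt.1 hneg, zero_le_one⟩
  obtain ⟨t, ht, ht0⟩ := intermediate_value_uIcc (hc.continuousOn (s := uIcc 0 s)) hmem
  have ht' : t ∈ Icc (-1 : ℝ) 1 :=
    (uIcc_subset_Icc (by norm_num) hs) ht
  exact h t ht' ht0

end Determinant

/-! ### Geometry of one time step: mesh velocity, Jacobians, conservation law. -/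

section Step

variable {d : ℕ} {M : Mesh d} {A A₀ A₁ B : Pt d → Pt d} {K : Finset (Pt d)} {v : Pt d → ℝ}

lemma interp_zero (A₀ A₁ : Pt d → Pt d) : interp A₀ A₁ 0 = A₀ := by
  funext Y; simp [interp]

lemma interp_one (A₀ A₁ : Pt d → Pt d) : interp A₀ A₁ 1 = A₁ := by
  funext Y; simp [interp]

/-- The Eulerian mesh velocity at the midpoint of a step from `A₀` to `A₁`. -/
def stepVel (M : Mesh d) (Δt : ℝ) (A₀ A₁ : Pt d → Pt d) : Pt d → Pt d :=
  push M (interp A₀ A₁ (1 / 2)) fun Y => Δt⁻¹ • (A₁ Y - A₀ Y)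

lemma diverg_affine (T : Pt d →L[ℝ] Pt d) (p q x : Pt d) :
    diverg (fun x => T (x - p) + q) x = LinearMap.trace ℝ _ (T : Pt d →ₗ[ℝ] Pt d) := by
  have h : HasFDerivAt (fun x => T (x - p) + q) T x := by
    have := (T.hasFDerivAt (x := x - p)).comp x ((hasFDerivAt_id x).sub_const p)
    exact this.add_const q
  rw [diverg, h.fderiv, LinearMap.trace_eq_sum_inner _ (EuclideanSpace.basisFun (Fin d) ℝ)]
  refine Finset.sum_congr rfl fun i _ => ?_
  simp [EuclideanSpace.inner_single_left]

/-- The spatial derivative of `(A₁ - A₀) ∘ A⁻¹`, in terms of the linear parts of the maps. -/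
def relLinear (L₀ L₁ L : Pt d ≃L[ℝ] Pt d) : Pt d →L[ℝ] Pt d :=
  ((L₁ : Pt d →L[ℝ] Pt d) - (L₀ : Pt d →L[ℝ] Pt d)) ∘L (L.symm : Pt d →L[ℝ] Pt d)

/-- Charts of the two end maps and of the midpoint map of a step, on one cell; in dimension at
most two the midpoint rule integrates the change of volume exactly. -/
lemma exists_step_charts (hA : ∀ θ ∈ Icc (0 : ℝ) 1, IsALEMap M (interp A₀ A₁ θ))
    (hK : K ∈ M.cells) :
    ∃ (L₀ L₁ L : Pt d ≃L[ℝ] Pt d) (p₀ p₁ p : Pt d), IsChart A₀ K L₀ p₀ ∧ IsChart A₁ K L₁ p₁ ∧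
      IsChart (interp A₀ A₁ (1 / 2)) K L p ∧
      (d ≤ 2 → |(L₁ : Pt d →L[ℝ] Pt d).det| - |(L₀ : Pt d →L[ℝ] Pt d).det|
        = |(L : Pt d →L[ℝ] Pt d).det| * LinearMap.trace ℝ _
          (relLinear L₀ L₁ L : Pt d →ₗ[ℝ] Pt d)) := by
  have h₀ := hA 0 (by norm_num)
  have h₁ := hA 1 (by norm_num)
  rw [interp_zero] at h₀
  rw [interp_one] at h₁
  obtain ⟨L₀, p₀, c₀⟩ := h₀.exists_chart hK
  obtain ⟨L₁, p₁, c₁⟩ := h₁.exists_chart hK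
  set D : Pt d →L[ℝ] Pt d := (L₁ : Pt d →L[ℝ] Pt d) - (L₀ : Pt d →L[ℝ] Pt d) with hD
  have hlin : ∀ θ : ℝ, ∀ Y ∈ cell K, interp A₀ A₁ θ Y
      = ((L₀ : Pt d →L[ℝ] Pt d) + θ • D) Y + (p₀ + θ • (p₁ - p₀)) := by
    intro θ Y hY
    simp only [interp, c₀ Y hY, c₁ Y hY, hD]
    simp
    module
  have hdet : ∀ θ ∈ Icc (0 : ℝ) 1, ((L₀ : Pt d →L[ℝ] Pt d) + θ • D).det ≠ 0 := fun θ hθ =>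
    det_ne_zero_of_injOn hK (hlin θ) ((hA θ hθ).injOn.mono (cell_subset_region hK))
  set L := ((L₀ : Pt d →L[ℝ] Pt d) + (1 / 2 : ℝ) • D).toContinuousLinearEquivOfDetNeZero
    (hdet (1 / 2) (by norm_num)) with hL
  have hLc : (L : Pt d →L[ℝ] Pt d) = (L₀ : Pt d →L[ℝ] Pt d) + (1 / 2 : ℝ) • D :=
    ContinuousLinearMap.coe_toContinuousLinearEquivOfDetNeZero _ _
  refine ⟨L₀, L₁, L, p₀, p₁, p₀ + (1 / 2 : ℝ) • (p₁ - p₀), c₀, c₁, fun Y hY => ?_, fun hd => ?_⟩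
  · rw [hlin _ Y hY, ← hLc]; rfl
  set Q : Pt d →L[ℝ] Pt d := relLinear L₀ L₁ L with hQ
  set X : Pt d →L[ℝ] Pt d := (1 / 2 : ℝ) • Q with hX
  have hQL : Q ∘L (L : Pt d →L[ℝ] Pt d) = D := by
    ext1 y; simp [hQ, relLinear, hD]
  -- The time is recentred by θ = (1 + s)/2: the midpoint is s = 0 and the ends are s = ±1.
  have hfac : ∀ s : ℝ, (L₀ : Pt d →L[ℝ] Pt d) + ((1 + s) / 2) • D
      = (1 + s • X) ∘L (L : Pt d →L[ℝ] Pt d) := by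
    intro s
    rw [ContinuousLinearMap.add_comp, hX, smul_smul, ContinuousLinearMap.smul_comp, hQL,
      show (1 : Pt d →L[ℝ] Pt d) ∘L (L : Pt d →L[ℝ] Pt d) = L from
        ContinuousLinearMap.id_comp _, hLc]
    module
  have hmul : ∀ s : ℝ, ((L₀ : Pt d →L[ℝ] Pt d) + ((1 + s) / 2) • D).det
      = (1 + s • X).det * (L : Pt d →L[ℝ] Pt d).det := fun s => by
    rw [hfac]
    exact LinearMap.det_comp ((1 + s • X : Pt d →L[ℝ] Pt d) : Pt d →ₗ[ℝ] Pt d)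
      ((L : Pt d →L[ℝ] Pt d) : Pt d →ₗ[ℝ] Pt d)
  have hne : ∀ s ∈ Icc (-1 : ℝ) 1, (1 + s • X).det ≠ 0 := fun s hs h => by
    have := hdet ((1 + s) / 2) ⟨by linarith [hs.1], by linarith [hs.2]⟩
    rw [hmul, h, zero_mul] at this
    exact this rfl
  have e₁ : (L₁ : Pt d →L[ℝ] Pt d).det = (1 + (1 : ℝ) • X).det * (L : Pt d →L[ℝ] Pt d).det := by
    rw [← hmul]
    congr 1
    rw [hD]
    module
  have e₀ : (L₀ : Pt d →L[ℝ] Pt d).det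
      = (1 + (-1 : ℝ) • X).det * (L : Pt d →L[ℝ] Pt d).det := by
    rw [← hmul]
    congr 1
    module
  have pos₁ := det_one_add_smul_pos hne (s := 1) (by norm_num)
  have pos₀ := det_one_add_smul_pos hne (s := -1) (by norm_num)
  rw [e₁, e₀, abs_mul, abs_mul, abs_of_pos pos₁, abs_of_pos pos₀, ← sub_mul, mul_comm]
  congr 1
  have h := LinearMap.det_one_add_sub_det_one_sub hd (X : Pt d →ₗ[ℝ] Pt d)
  have h1 : (1 + (1 : ℝ) • X).det = LinearMap.det (1 + (X : Pt d →ₗ[ℝ] Pt d)) := by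
    rw [one_smul]; rfl
  have h2 : (1 + (-1 : ℝ) • X).det = LinearMap.det (1 - (X : Pt d →ₗ[ℝ] Pt d)) := by
    rw [show 1 + (-1 : ℝ) • X = 1 - X by module]; rfl
  rw [h1, h2, h]
  have h3 : (X : Pt d →ₗ[ℝ] Pt d) = (1 / 2 : ℝ) • (Q : Pt d →ₗ[ℝ] Pt d) := rfl
  rw [h3, map_smul, smul_eq_mul]
  ring

lemma stepVel_eqOn (Δt : ℝ) (hA : IsALEMap M (interp A₀ A₁ (1 / 2))) (hK : K ∈ M.cells)
    {L₀ L₁ L : Pt d ≃L[ℝ] Pt d} {p₀ p₁ p : Pt d} (c₀ : IsChart A₀ K L₀ p₀)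
    (c₁ : IsChart A₁ K L₁ p₁) (c : IsChart (interp A₀ A₁ (1 / 2)) K L p) :
    EqOn (stepVel M Δt A₀ A₁)
      (fun x => (Δt⁻¹ • relLinear L₀ L₁ L) (x - p)
        + Δt⁻¹ • (p₁ - p₀))
      (interp A₀ A₁ (1 / 2) '' cell K) := by
  intro x hx
  have hY := c.mem_image_iff.1 hx
  rw [stepVel, hA.push_eq hK c _ hx, c₀ _ hY, c₁ _ hY]
  change _ = Δt⁻¹ • (L₁ (L.symm (x - p)) - L₀ (L.symm (x - p))) + Δt⁻¹ • (p₁ - p₀)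
  module

lemma exists_lipschitzOnWith_stepVel (Δt : ℝ)
    (hA : ∀ θ ∈ Icc (0 : ℝ) 1, IsALEMap M (interp A₀ A₁ θ)) (hK : K ∈ M.cells) :
    ∃ C, LipschitzOnWith C (stepVel M Δt A₀ A₁) (interp A₀ A₁ (1 / 2) '' cell K) := by
  obtain ⟨L₀, L₁, L, p₀, p₁, p, c₀, c₁, c, -⟩ := exists_step_charts hA hK
  have hw := stepVel_eqOn Δt (hA (1 / 2) (by norm_num)) hK c₀ c₁ c
  set T := Δt⁻¹ • relLinear L₀ L₁ L
  refine ⟨‖T‖₊, LipschitzOnWith.of_dist_le_mul fun x hx y hy => ?_⟩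
  rw [hw hx, hw hy, dist_add_right]
  simpa using T.lipschitz.dist_le_mul (x - p) (y - p)

lemma ae_abs_le_linf_moved {g : Pt d → ℝ}
    (hg : ∀ K ∈ M.cells, ∃ C, ∀ᵐ x ∂(volume.restrict (A '' cell K)), |g x| ≤ C) :
    ∀ᵐ x ∂(volume.restrict (M.moved A)), |g x| ≤ linf (M.moved A) g := by
  have hg' : ∀ K : M.cells, ∃ C, ∀ᵐ x ∂(volume.restrict (A '' cell K.1)), |g x| ≤ C :=
    fun K => hg K K.2
  choose C hC using hg'
  refine ae_abs_le_linf (C := ∑ K, |C K|) (ae_moved (M := M) (A := A) fun K hK => ?_)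
  have hCK := hC (⟨K, hK⟩ : M.cells)
  filter_upwards [hCK] with x hx
  refine hx.trans ((le_abs_self _).trans ?_)
  exact Finset.single_le_sum (f := fun K => |C K|) (fun _ _ => abs_nonneg _)
    (Finset.mem_univ (⟨K, hK⟩ : M.cells))

lemma IsALEMap.integral_push_sq (hA : IsALEMap M A) (hK : K ∈ M.cells) {L : Pt d ≃L[ℝ] Pt d}
    {p : Pt d} (h : IsChart A K L p) (v : Pt d → ℝ) :
    ∫ x in A '' cell K, push M A v x ^ 2
      = |(L : Pt d →L[ℝ] Pt d).det| * ∫ Y in cell K, v Y ^ 2 := by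
  rw [h.integral_image]
  congr 1
  refine setIntegral_congr_fun (isCompact_cell K).isClosed.measurableSet fun Y hY => ?_
  simp only [hA.push_apply v (cell_subset_region hK hY)]

lemma IsALEMap.integrableOn_push_sq (hA : IsALEMap M A) (hv : IsConforming M v)
    (hK : K ∈ M.cells) : IntegrableOn (fun x => push M A v x ^ 2) (A '' cell K) := by
  simp only [pow_two]
  exact integrableOn_of_memLp_top (hA.isCompact_image hK)
    (memLp_top_mul (hA.memLp_push hv hK) (hA.memLp_push hv hK))

lemma IsALEMap.l2sq_push (hA : IsALEMap M A) (hv : IsConforming M v) :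
    l2sq (M.moved A) (push M A v) = ∑ K ∈ M.cells, ∫ x in A '' cell K, push M A v x ^ 2 :=
  hA.integral_moved fun _ hK => hA.integrableOn_push_sq hv hK

/-- The map between the two domains is affine on each cell, with linear part L ∘ L₁⁻¹;
multiplicativity of the determinant gives the product form. -/
lemma jac_ae_eq (hA : IsALEMap M A) (hK : K ∈ M.cells)
    {L₁ L : Pt d ≃L[ℝ] Pt d} {p₁ p : Pt d} (c₁ : IsChart A K L₁ p₁) (c : IsChart B K L p) :
    ∀ᵐ x ∂(volume.restrict (A '' cell K)),
      jac M A B x * |(L₁ : Pt d →L[ℝ] Pt d).det| = |(L : Pt d →L[ℝ] Pt d).det| := by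
  filter_upwards [c₁.ae_mem_interior] with x hx
  set T : Pt d →L[ℝ] Pt d := (L : Pt d →L[ℝ] Pt d) ∘L (L₁.symm : Pt d →L[ℝ] Pt d)
  have hev : push M A B =ᶠ[nhds x] fun x => T (x - p₁) + p :=
    eventuallyEq_of_mem_interior (T := A '' cell K) (fun y hy => by
      rw [hA.push_eq hK c₁ B hy, c _ (c₁.mem_image_iff.1 hy)]; rfl) hx
  have h : HasFDerivAt (fun x => T (x - p₁) + p) T x := by
    have := (T.hasFDerivAt (x := x - p₁)).comp x ((hasFDerivAt_id x).sub_const p₁)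
    exact this.add_const p
  rw [jac, hev.fderiv_eq, h.fderiv, ← abs_mul]
  congr 1
  have h2 : T ∘L (L₁ : Pt d →L[ℝ] Pt d) = (L : Pt d →L[ℝ] Pt d) := by
    ext1 y; simp [T]
  rw [← h2]
  exact (LinearMap.det_comp (T : Pt d →ₗ[ℝ] Pt d)
    ((L₁ : Pt d →L[ℝ] Pt d) : Pt d →ₗ[ℝ] Pt d)).symm

/-- Change of domain for the `L²` norm. -/
lemma l2sq_push_le (hA : IsALEMap M A) (hB : IsALEMap M B) (hv : IsConforming M v) :
    l2sq (M.moved B) (push M B v)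
      ≤ linf (M.moved A) (jac M A B) * l2sq (M.moved A) (push M A v) := by
  have hlinf : ∀ᵐ x ∂(volume.restrict (M.moved A)),
      |jac M A B x| ≤ linf (M.moved A) (jac M A B) := by
    refine ae_abs_le_linf_moved fun K hK => ?_
    obtain ⟨L₁, p₁, c₁⟩ := hA.exists_chart hK
    obtain ⟨L, p, c⟩ := hB.exists_chart hK
    refine ⟨|(L : Pt d →L[ℝ] Pt d).det| / |(L₁ : Pt d →L[ℝ] Pt d).det|, ?_⟩
    filter_upwards [jac_ae_eq hA hK c₁ c] with x hx
    have hpos : 0 < |(L₁ : Pt d →L[ℝ] Pt d).det| := abs_pos.2 L₁.toLinearEquiv.isUnit_det'.ne_zero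
    rw [abs_of_nonneg (show 0 ≤ jac M A B x from abs_nonneg _), le_div_iff₀ hpos, hx]
  rw [hA.l2sq_push hv, hB.l2sq_push hv, Finset.mul_sum]
  refine Finset.sum_le_sum fun K hK => ?_
  obtain ⟨L₁, p₁, c₁⟩ := hA.exists_chart hK
  obtain ⟨L, p, c⟩ := hB.exists_chart hK
  rw [hA.integral_push_sq hK c₁, hB.integral_push_sq hK c, ← mul_assoc]
  refine mul_le_mul_of_nonneg_right ?_ (integral_nonneg fun _ => sq_nonneg _)
  -- The cell has positive measure, so some point satisfies both the a.e. Jacobian identity and the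
  -- essential bound. As the Jacobian is a.e. constant on the cell, that one point suffices.
  have hne : NeZero (volume.restrict (A '' cell K)) := by
    refine ⟨fun h0 => ?_⟩
    have h1 := Measure.restrict_eq_zero.1 h0
    exact ((isOpen_interior.measure_pos volume (c₁.interior_nonempty hK)).trans_le
      (measure_mono interior_subset)).ne' h1
  obtain ⟨x, hx1, hx2⟩ := ((jac_ae_eq hA hK c₁ c).and (ae_image_cell hK hlinf)).exists
  rw [← hx1]
  gcongr
  exact (le_abs_self _).trans hx2

lemma exists_ae_abs_diverg_le (hA : IsALEMap M A) (hK : K ∈ M.cells) {B : Pt d → Pt d}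
    (hB : ∃ C, LipschitzOnWith C B (A '' cell K)) :
    ∃ C, ∀ᵐ x ∂(volume.restrict (A '' cell K)), |diverg B x| ≤ C := by
  obtain ⟨C, hC⟩ := hB
  refine ⟨d * C, ?_⟩
  filter_upwards [hA.ae_mem_interior hK] with x hx
  exact abs_diverg_le (mem_interior_iff_mem_nhds.1 hx) hC

/-- In dimension at most two, the midpoint rule satisfies the geometric conservation law. -/
lemma geometric_conservation (hd : d ≤ 2) {Δt : ℝ} (hΔt : Δt ≠ 0)
    (hA : ∀ θ ∈ Icc (0 : ℝ) 1, IsALEMap M (interp A₀ A₁ θ)) (hv : IsConforming M v) :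
    l2sq (M.moved A₁) (push M A₁ v) - l2sq (M.moved A₀) (push M A₀ v)
      = Δt * ∫ x in M.moved (interp A₀ A₁ (1 / 2)),
          push M (interp A₀ A₁ (1 / 2)) v x ^ 2 * diverg (stepVel M Δt A₀ A₁) x := by
  have h₀ := hA 0 (by norm_num)
  have h₁ := hA 1 (by norm_num)
  rw [interp_zero] at h₀
  rw [interp_one] at h₁
  have h := hA (1 / 2) (by norm_num)
  rw [h₀.l2sq_push hv, h₁.l2sq_push hv, h.integral_moved, Finset.mul_sum,
    ← Finset.sum_sub_distrib]
  · refine Finset.sum_congr rfl fun K hK => ?_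
    obtain ⟨L₀, L₁, L, p₀, p₁, p, c₀, c₁, c, hdet⟩ := exists_step_charts hA hK
    have hw := stepVel_eqOn Δt h hK c₀ c₁ c
    have hdiv : ∀ᵐ x ∂(volume.restrict (interp A₀ A₁ (1 / 2) '' cell K)),
        push M (interp A₀ A₁ (1 / 2)) v x ^ 2 * diverg (stepVel M Δt A₀ A₁) x
          = push M (interp A₀ A₁ (1 / 2)) v x ^ 2 * (Δt⁻¹ * LinearMap.trace ℝ _
          (relLinear L₀ L₁ L : Pt d →ₗ[ℝ] Pt d)) := by
      filter_upwards [c.ae_mem_interior] with x hx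
      rw [diverg_congr (eventuallyEq_of_mem_interior hw hx), diverg_affine,
        ContinuousLinearMap.toLinearMap_smul, map_smul, smul_eq_mul]
    rw [integral_congr_ae hdiv, integral_mul_const, h.integral_push_sq hK c,
      h₀.integral_push_sq hK c₀, h₁.integral_push_sq hK c₁, ← sub_mul, hdet hd]
    field_simp
  · intro K hK
    simp only [pow_two]
    obtain ⟨C, hC⟩ := exists_lipschitzOnWith_stepVel Δt hA hK
    exact integrableOn_of_memLp_top (h.isCompact_image hK)
      (memLp_top_mul (memLp_top_mul (h.memLp_push hv hK) (h.memLp_push hv hK))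
        (memLp_top_diverg (h.ae_mem_interior hK) hC))

end Step

/-! ### Discrete Gronwall inequality. -/

section Gronwall

/-- Discrete Gronwall lemma for a recursion with an implicit and an explicit growth term. -/
lemma discrete_gronwall {N : ℕ} {h : ℝ} {a D F β₁ β₂ : ℕ → ℝ} (hh : 0 ≤ h)
    (ha : ∀ n, 0 ≤ a n) (hD : ∀ n ≤ N, 0 ≤ D n) (hF : ∀ n ≤ N, 0 ≤ F n)
    (hβ₁ : ∀ n, 0 ≤ β₁ n) (hβ₂ : ∀ n, 0 ≤ β₂ n)
    (hlt : ∀ n ∈ Finset.Icc 1 (N + 1), h * (β₁ n + β₂ n) < 1)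
    (hrec : ∀ n ≤ N, a (n + 1) - a n + D n
      ≤ h * (β₁ (n + 1) * a (n + 1) + β₂ n * a n) + F n) :
    a (N + 1) + ∑ n ∈ Finset.range (N + 1), D n
      ≤ ((1 + h * β₂ 0) * a 0 + ∑ n ∈ Finset.range (N + 1), F n)
        * Real.exp (h * ∑ n ∈ Finset.Icc 1 (N + 1),
            (β₁ n + β₂ n) / (1 - h * (β₁ n + β₂ n))) := by
  -- Carrying the explicit term h β₂ a of the next step on the left pairs β₁ and β₂ at the same
  -- index; each step then loses a factor 1 - h(β₁ + β₂).
  have key : ∀ m ≤ N + 1,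
      (1 + h * β₂ m) * a m + ∑ n ∈ Finset.range m, D n
        ≤ ((1 + h * β₂ 0) * a 0 + ∑ n ∈ Finset.range m, F n)
          * Real.exp (h * ∑ n ∈ Finset.Icc 1 m,
              (β₁ n + β₂ n) / (1 - h * (β₁ n + β₂ n))) := by
    intro m
    induction m with
    | zero => intro _; simp
    | succ m ih =>
      intro hm
      have hmN : m ≤ N := by omega
      have ih := ih (by omega)
      rw [Finset.sum_range_succ, Finset.sum_range_succ,
        Finset.sum_Icc_succ_top (by omega : 1 ≤ m + 1), mul_add h, Real.exp_add]
      set σ := h * ∑ n ∈ Finset.Icc 1 m, (β₁ n + β₂ n) / (1 - h * (β₁ n + β₂ n)) with hσ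
      set γ := β₁ (m + 1) + β₂ (m + 1) with hγ
      have hγ0 : 0 ≤ γ := add_nonneg (hβ₁ _) (hβ₂ _)
      have hγ1 : h * γ < 1 := hlt _ (by simp; omega)
      have hσ0 : 0 ≤ σ := by
        refine mul_nonneg hh (Finset.sum_nonneg fun n hn => ?_)
        have hn' := Finset.mem_Icc.1 hn
        have := hlt n (Finset.mem_Icc.2 ⟨hn'.1, by omega⟩)
        exact div_nonneg (add_nonneg (hβ₁ _) (hβ₂ _)) (by linarith)
      have hS : 0 ≤ ∑ n ∈ Finset.range m, D n :=
        Finset.sum_nonneg fun n hn => hD n (by have := Finset.mem_range.1 hn; omega)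
      have hDm := hD m hmN
      have hFm := hF m hmN
      set E := (1 + h * β₂ (m + 1)) * a (m + 1) + (∑ n ∈ Finset.range m, D n + D m) with hE
      set R := ((1 + h * β₂ 0) * a 0 + ∑ n ∈ Finset.range m, F n) * Real.exp σ with hR
      have haE : a (m + 1) ≤ E := by
        have : 0 ≤ h * β₂ (m + 1) * a (m + 1) :=
          mul_nonneg (mul_nonneg hh (hβ₂ _)) (ha _)
        rw [hE]; linarith
      have h1 : (1 - h * γ) * E ≤ R + F m := by
        have h2 : h * γ * a (m + 1) ≤ h * γ * E :=
          mul_le_mul_of_nonneg_left haE (mul_nonneg hh hγ0)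
        have h3 := hrec m hmN
        have h4 : E = a (m + 1) + D m + h * β₂ (m + 1) * a (m + 1)
          + ∑ n ∈ Finset.range m, D n := by rw [hE]; ring
        have h5 : h * γ * a (m + 1)
          = h * (β₁ (m + 1) * a (m + 1)) + h * β₂ (m + 1) * a (m + 1) := by rw [hγ]; ring
        linarith
      -- With x = hγ and y = x/(1 - x), this is 1 + y ≤ exp y, because 1 + y = 1/(1 - x).
      have hexp : 1 ≤ (1 - h * γ) * Real.exp (h * (γ / (1 - h * γ))) := by
        have hp : 0 < 1 - h * γ := by linarith
        have h2 := Real.add_one_le_exp (h * (γ / (1 - h * γ)))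
        have h3 : (1 - h * γ) * (h * (γ / (1 - h * γ)) + 1) = 1 := by
          field_simp
          ring
        exact h3.symm.trans_le (mul_le_mul_of_nonneg_left h2 hp.le)
      have hE0 : 0 ≤ E := (ha _).trans haE
      have hσ1 : 1 ≤ Real.exp σ := Real.one_le_exp hσ0
      calc E ≤ E * ((1 - h * γ) * Real.exp (h * (γ / (1 - h * γ)))) :=
            le_mul_of_one_le_right hE0 hexp
        _ = (1 - h * γ) * E * Real.exp (h * (γ / (1 - h * γ))) := by ring
        _ ≤ (R + F m) * Real.exp (h * (γ / (1 - h * γ))) := by gcongr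
        _ ≤ (R + F m * Real.exp σ) * Real.exp (h * (γ / (1 - h * γ))) := by
            gcongr
            exact le_mul_of_one_le_right hFm hσ1
        _ = _ := by rw [hR]; ring
  refine le_trans ?_ (key (N + 1) le_rfl)
  have : 0 ≤ h * β₂ (N + 1) * a (N + 1) := mul_nonneg (mul_nonneg hh (hβ₂ _)) (ha _)
  linarith

end Gronwall

/-! ### Coercivity of the SUPG form. -/

section Coercivity

variable {d : ℕ} {M : Mesh d} {A : Pt d → Pt d} {v : Pt d → ℝ}

lemma gradient_const_mul (a : ℝ) (u : Pt d → ℝ) (x : Pt d) :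
    gradient (fun y => a * u y) x = a • gradient u x := by
  have h : fderiv ℝ (fun y => a * u y) x = a • fderiv ℝ u x :=
    congrFun (fderiv_const_smul_field (𝕜 := ℝ) (f := u) a) x
  simp only [gradient, h, map_smul]

lemma tripleSq_const_mul (M : Mesh d) (A : Pt d → Pt d) (δ : Finset (Pt d) → ℝ) (ε μ a : ℝ)
    (b w : Pt d → Pt d) (u : Pt d → ℝ) :
    tripleSq M A δ ε μ b w (fun x => a * u x) = a ^ 2 * tripleSq M A δ ε μ b w u := by
  have h : ∀ K, δ K * (a ^ 2 * ∫ x in A '' cell K, inner ℝ (b x - w x) (gradient u x) ^ 2)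
      = a ^ 2 * (δ K * ∫ x in A '' cell K, inner ℝ (b x - w x) (gradient u x) ^ 2) :=
    fun K => by ring
  simp only [tripleSq, l2sq, gradient_const_mul, norm_smul, inner_smul_right, mul_pow,
    integral_const_mul, Real.norm_eq_abs, sq_abs, h, ← Finset.mul_sum]
  ring

lemma tripleSq_nonneg (M : Mesh d) (A : Pt d → Pt d) {δ : Finset (Pt d) → ℝ} {ε μ : ℝ}
    (hε : 0 ≤ ε) (hμ : 0 ≤ μ) (hδ : ∀ K ∈ M.cells, 0 ≤ δ K)
    (b w : Pt d → Pt d) (u : Pt d → ℝ) : 0 ≤ tripleSq M A δ ε μ b w u := by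
  refine add_nonneg (add_nonneg (mul_nonneg hε (integral_nonneg fun _ => sq_nonneg _))
    (Finset.sum_nonneg fun K hK => mul_nonneg (hδ K hK) (integral_nonneg fun _ => sq_nonneg _)))
    (mul_nonneg hμ (l2sq_nonneg _ _))

/-- For d ≥ 1 a cell has two distinct vertices. Positivity allows h_K² to be cancelled in the
inverse inequality. -/
lemma IsALEMap.diam_pos (hd : 1 ≤ d) (hA : IsALEMap M A) {K : Finset (Pt d)} (hK : K ∈ M.cells) :
    0 < Metric.diam (A '' cell K) := by
  have hcard : 1 < K.card := by rw [M.card_eq K hK]; omega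
  obtain ⟨x, hx, y, hy, hxy⟩ := Finset.one_lt_card.1 hcard
  have hx' : x ∈ cell K := subset_convexHull ℝ _ hx
  have hy' : y ∈ cell K := subset_convexHull ℝ _ hy
  have hne : A x ≠ A y := fun h =>
    hxy (hA.injOn (cell_subset_region hK hx') (cell_subset_region hK hy') h)
  exact (dist_pos.2 hne).trans_le (Metric.dist_le_diam_of_mem (hA.isCompact_image hK).isBounded
    (mem_image_of_mem A hx') (mem_image_of_mem A hy'))

lemma memLp_top_streamline {T : Set (Pt d)} {b w : Pt d → Pt d} {u : Pt d → ℝ} {C D : NNReal}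
    (hT : IsCompact T) (hb : LipschitzOnWith C b T) (hw : LipschitzOnWith D w T)
    (hu : MemLp (gradient u) ⊤ (volume.restrict T)) :
    MemLp (fun x => inner ℝ (b x - w x) (gradient u x)) ⊤ (volume.restrict T) :=
  memLp_top_inner ((memLp_top_of_lipschitzOnWith hT hb).sub (memLp_top_of_lipschitzOnWith hT hw))
    hu

lemma IsALEMap.integrableOn_norm_gradient_sq (hA : IsALEMap M A) (hv : IsConforming M v)
    {K : Finset (Pt d)} (hK : K ∈ M.cells) :
    IntegrableOn (fun x => ‖gradient (push M A v) x‖ ^ 2) (A '' cell K) := by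
  simp only [← real_inner_self_eq_norm_sq]
  exact integrableOn_of_memLp_top (hA.isCompact_image hK)
    (memLp_top_inner (hA.memLp_gradient hv hK) (hA.memLp_gradient hv hK))

/-- Lower bound for the stabilization term on one cell. -/
lemma stabilization_lower_bound {T : Set (Pt d)} {L g c u : Pt d → ℝ} {ε δ μ I : ℝ}
    (hT : IsCompact T) (hL : MemLp L ⊤ (volume.restrict T)) (hg : MemLp g ⊤ (volume.restrict T))
    (hc : MemLp c ⊤ (volume.restrict T)) (hu : MemLp u ⊤ (volume.restrict T))
    (hδ : 0 ≤ δ) (hδc : 2 * linf T c ^ 2 * δ ≤ μ) (hε : 0 ≤ ε)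
    (hinv : 2 * ε * δ * ∫ x in T, L x ^ 2 ≤ I) :
    1 / 2 * (δ * ∫ x in T, g x ^ 2) - ε / 2 * I - μ / 2 * ∫ x in T, u x ^ 2
      ≤ δ * ∫ x in T, (-ε * L x + g x + c x * u x) * g x := by
  have sq {h : Pt d → ℝ} (hh : MemLp h ⊤ (volume.restrict T)) :
      IntegrableOn (fun x => h x ^ 2) T := by
    simp only [pow_two]
    exact integrableOn_of_memLp_top hT (memLp_top_mul hh hh)
  have hint : IntegrableOn (fun x => (-ε * L x + g x + c x * u x) * g x) T :=
    integrableOn_of_memLp_top hT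
      (memLp_top_mul (((hL.const_mul (-ε)).add hg).add (memLp_top_mul hc hu)) hg)
  have hle : 1 / 2 * (∫ x in T, g x ^ 2) - ε ^ 2 * (∫ x in T, L x ^ 2)
      - linf T c ^ 2 * (∫ x in T, u x ^ 2)
      ≤ ∫ x in T, (-ε * L x + g x + c x * u x) * g x := by
    have hgL : IntegrableOn (fun x => 1 / 2 * g x ^ 2 - ε ^ 2 * L x ^ 2) T :=
      ((sq hg).const_mul _).sub ((sq hL).const_mul _)
    rw [← integral_const_mul, ← integral_const_mul, ← integral_const_mul,
      ← integral_sub ((sq hg).const_mul _) ((sq hL).const_mul _),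
      ← integral_sub hgL ((sq hu).const_mul _)]
    refine integral_mono_ae (hgL.sub ((sq hu).const_mul _)) hint ?_
    filter_upwards [ae_abs_le_linf_of_memLp hc] with x hx
    have h1 : c x ^ 2 ≤ linf T c ^ 2 := sq_le_sq' (by linarith [neg_abs_le (c x)])
      ((le_abs_self _).trans hx)
    have h2 : c x ^ 2 * u x ^ 2 ≤ linf T c ^ 2 * u x ^ 2 :=
      mul_le_mul_of_nonneg_right h1 (sq_nonneg _)
    -- Young's inequality twice: each cross term costs g²/4, which leaves half of g².
    nlinarith [sq_nonneg (ε * L x - g x / 2), sq_nonneg (c x * u x + g x / 2)]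
  have hu0 : 0 ≤ ∫ x in T, u x ^ 2 := integral_nonneg fun _ => sq_nonneg _
  have h1 := mul_le_mul_of_nonneg_left hle hδ
  have h2 := mul_le_mul_of_nonneg_right hδc hu0
  have h3 := mul_le_mul_of_nonneg_left hinv hε
  linarith

/-- Coercivity of the SUPG form. -/
lemma half_tripleSq_le_aSUPG (hd : 1 ≤ d) (hA : IsALEMap M A) (hv : IsConforming M v)
    {b w : Pt d → Pt d} {c : Pt d → ℝ} {δ : Finset (Pt d) → ℝ} {ε μ cinv : ℝ} (hε : 0 ≤ ε)
    (hb : ∃ L, LipschitzOnWith L b (M.moved A))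
    (hw : ∀ K ∈ M.cells, ∃ L, LipschitzOnWith L w (A '' cell K))
    (hc : MemLp c ⊤ (volume.restrict (M.moved A)))
    (hcoer : ∀ᵐ x ∂(volume.restrict (M.moved A)), μ ≤ c x - 1 / 2 * diverg b x)
    (hinv : ∀ K ∈ M.cells, Metric.diam (A '' cell K) ^ 2 *
        (∫ x in A '' cell K, (Laplacian.laplacian (push M A v) x) ^ 2)
      ≤ cinv ^ 2 * ∫ x in A '' cell K, ‖gradient (push M A v) x‖ ^ 2)
    (hδ0 : ∀ K ∈ M.cells, 0 ≤ δ K)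
    (hδ1 : ∀ K ∈ M.cells, 2 * linf (A '' cell K) c ^ 2 * δ K ≤ μ)
    (hδ2 : ∀ K ∈ M.cells, 2 * ε * cinv ^ 2 * δ K ≤ Metric.diam (A '' cell K) ^ 2) :
    1 / 2 * tripleSq M A δ ε μ b w (push M A v)
      ≤ aSUPG M A δ ε b w c (push M A v) (push M A v) := by
  obtain ⟨Lb, hb⟩ := hb
  have hbK : ∀ K ∈ M.cells, ∃ C, LipschitzOnWith C b (A '' cell K) :=
    fun K hK => ⟨Lb, hb.mono (image_cell_subset_moved hK)⟩
  have hcK : ∀ K ∈ M.cells, MemLp c ⊤ (volume.restrict (A '' cell K)) := fun K hK =>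
    hc.mono_measure (Measure.restrict_mono_set _ (image_cell_subset_moved hK))
  have hibp := hA.integral_inner_gradient_mul hv hbK
  set u := push M A v with hu
  have hsq := fun K hK => hA.integrableOn_push_sq hv (K := K) hK
  have hgr := fun K hK => hA.integrableOn_norm_gradient_sq hv (K := K) hK
  have hstab : ∀ K ∈ M.cells,
      1 / 2 * (δ K * ∫ x in A '' cell K, inner ℝ (b x - w x) (gradient u x) ^ 2)
        - ε / 2 * (∫ x in A '' cell K, ‖gradient u x‖ ^ 2)
        - μ / 2 * (∫ x in A '' cell K, u x ^ 2)
      ≤ δ K * ∫ x in A '' cell K,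
        (-ε * Laplacian.laplacian u x + inner ℝ (b x - w x) (gradient u x) + c x * u x)
          * inner ℝ (b x - w x) (gradient u x) := by
    intro K hK
    obtain ⟨Cb, hbK⟩ := hbK K hK
    obtain ⟨Cw, hwK⟩ := hw K hK
    have hT := hA.isCompact_image hK
    refine stabilization_lower_bound hT (hA.memLp_laplacian hv hK)
      (memLp_top_streamline hT hbK hwK (hA.memLp_gradient hv hK)) (hcK K hK)
      (hA.memLp_push hv hK) (hδ0 K hK) (hδ1 K hK) hε ?_
    have hdiam : 0 < Metric.diam (A '' cell K) ^ 2 := pow_pos (hA.diam_pos hd hK) 2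
    have hg0 : 0 ≤ ∫ x in A '' cell K, ‖gradient u x‖ ^ 2 := integral_nonneg fun _ => sq_nonneg _
    have h1 := mul_le_mul_of_nonneg_left (hinv K hK)
      (mul_nonneg (mul_nonneg zero_le_two hε) (hδ0 K hK))
    have h2 := mul_le_mul_of_nonneg_right (hδ2 K hK) hg0
    -- Multiplied by h_K², the claim chains the inverse inequality with 2ε cinv² δ ≤ h_K².
    refine le_of_mul_le_mul_left (le_trans ?_ (h1.trans (le_trans (le_of_eq ?_) h2))) hdiam
    · exact le_of_eq (by ring)
    · ring
  have hi1 : IntegrableOn (fun x => diverg b x * u x ^ 2) (M.moved A) :=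
    hA.integrableOn_moved fun K hK => by
      obtain ⟨D, hD⟩ := hbK K hK
      have hu' := hA.memLp_push hv hK
      simp only [pow_two]
      exact integrableOn_of_memLp_top (hA.isCompact_image hK)
        (memLp_top_mul (memLp_top_diverg (hA.ae_mem_interior hK) hD) (memLp_top_mul hu' hu'))
  have hi2 : IntegrableOn (fun x => c x * u x * u x) (M.moved A) :=
    hA.integrableOn_moved fun K hK =>
      integrableOn_of_memLp_top (hA.isCompact_image hK)
        (memLp_top_mul (memLp_top_mul (hcK K hK) (hA.memLp_push hv hK)) (hA.memLp_push hv hK))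
  -- Integration by parts turns the convection term into -1/2 (div b, u²), so that c - 1/2 div b ≥ μ
  -- applies.
  have hmass : μ * (∫ x in M.moved A, u x ^ 2)
      ≤ (∫ x in M.moved A, inner ℝ (b x) (gradient u x) * u x)
        + ∫ x in M.moved A, c x * u x * u x := by
    have h1 : μ * (∫ x in M.moved A, u x ^ 2)
        ≤ (∫ x in M.moved A, c x * u x * u x)
          - 1 / 2 * ∫ x in M.moved A, diverg b x * u x ^ 2 := by
      rw [← integral_const_mul, ← integral_const_mul,
        ← integral_sub hi2 (hi1.const_mul _)]
      refine integral_mono_ae ((hA.integrableOn_moved hsq).const_mul _)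
        (hi2.sub (hi1.const_mul _)) ?_
      filter_upwards [hcoer] with x hx
      have := mul_le_mul_of_nonneg_right hx (sq_nonneg (u x))
      linarith
    linarith
  have hsum := Finset.sum_le_sum hstab
  rw [Finset.sum_sub_distrib, Finset.sum_sub_distrib, ← Finset.mul_sum, ← Finset.mul_sum,
    ← Finset.mul_sum, ← hA.integral_moved hsq, ← hA.integral_moved hgr] at hsum
  simp only [tripleSq, aSUPG, l2sq, real_inner_self_eq_norm_sq]
  linarith

end Coercivity

/-! ### Estimate of the load. -/

section Load

variable {d : ℕ} {M : Mesh d} {A : Pt d → Pt d} {v : Pt d → ℝ}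

lemma integral_mul_le_of_sq_le {T : Set (Pt d)} {f g : Pt d → ℝ} {α β : ℝ} (hT : IsCompact T)
    (hf : MemLp f 2 (volume.restrict T)) (hg : MemLp g ⊤ (volume.restrict T))
    (h : ∀ s t : ℝ, s * t ≤ α * s ^ 2 + β * t ^ 2) :
    IntegrableOn (fun x => f x * g x) T ∧
      ∫ x in T, f x * g x ≤ α * (∫ x in T, f x ^ 2) + β * ∫ x in T, g x ^ 2 := by
  have : IsFiniteMeasure (volume.restrict T) := ⟨by simpa using hT.measure_lt_top⟩
  have hg2 : MemLp g 2 (volume.restrict T) := hg.mono_exponent le_top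
  have hfg : IntegrableOn (fun x => f x * g x) T := hf.integrable_mul hg2
  refine ⟨hfg, ?_⟩
  rw [← integral_const_mul, ← integral_const_mul,
    ← integral_add (hf.integrable_sq.const_mul _) (hg2.integrable_sq.const_mul _)]
  exact integral_mono hfg ((hf.integrable_sq.const_mul _).add (hg2.integrable_sq.const_mul _))
    fun x => h _ _

/-- Bound for the load terms, including the stabilization. -/
lemma load_le (hA : IsALEMap M A) (hv : IsConforming M v) {b w : Pt d → Pt d} {f : Pt d → ℝ}
    {δ : Finset (Pt d) → ℝ} {ε μ Δt : ℝ} (hε : 0 ≤ ε) (hμ : 0 < μ)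
    (hb : ∃ L, LipschitzOnWith L b (M.moved A))
    (hw : ∀ K ∈ M.cells, ∃ L, LipschitzOnWith L w (A '' cell K))
    (hf : MemLp f 2 (volume.restrict (M.moved A)))
    (hδ0 : ∀ K ∈ M.cells, 0 ≤ δ K) (hδ3 : ∀ K ∈ M.cells, δ K ≤ Δt / 4) :
    (∫ x in M.moved A, f x * push M A v x)
        + (∑ K ∈ M.cells, δ K *
          ∫ x in A '' cell K, f x * inner ℝ (b x - w x) (gradient (push M A v) x))
      ≤ (1 / μ + Δt / 4) * l2sq (M.moved A) f
        + 1 / 4 * tripleSq M A δ ε μ b w (push M A v) := by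
  obtain ⟨Lb, hb⟩ := hb
  have hfK : ∀ K ∈ M.cells, MemLp f 2 (volume.restrict (A '' cell K)) := fun K hK =>
    hf.mono_measure (Measure.restrict_mono_set _ (image_cell_subset_moved hK))
  set u := push M A v with hu
  have hfi : ∀ K ∈ M.cells, IntegrableOn (fun x => f x ^ 2) (A '' cell K) :=
    fun K hK => (hfK K hK).integrable_sq
  -- The weights are chosen so that u costs only a quarter of the mass part of the triple norm.
  have hy : ∀ s t : ℝ, s * t ≤ 1 / μ * s ^ 2 + μ / 4 * t ^ 2 := fun s t => by
    have : 1 / μ * s ^ 2 + μ / 4 * t ^ 2 - s * t = μ * (s / μ - t / 2) ^ 2 := by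
      field_simp
      ring
    have h2 : 0 ≤ μ * (s / μ - t / 2) ^ 2 := by positivity
    linarith
  have h1 : (∫ x in M.moved A, f x * u x)
      ≤ 1 / μ * (∫ x in M.moved A, f x ^ 2) + μ / 4 * ∫ x in M.moved A, u x ^ 2 := by
    rw [hA.integral_moved fun K hK => (integral_mul_le_of_sq_le (hA.isCompact_image hK)
        (hfK K hK) (hA.memLp_push hv hK) hy).1, hA.integral_moved hfi,
      hA.integral_moved fun K hK => hA.integrableOn_push_sq hv hK, Finset.mul_sum,
      Finset.mul_sum, ← Finset.sum_add_distrib]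
    exact Finset.sum_le_sum fun K hK => (integral_mul_le_of_sq_le (hA.isCompact_image hK)
        (hfK K hK) (hA.memLp_push hv hK) hy).2
  have h2 : (∑ K ∈ M.cells, δ K * ∫ x in A '' cell K, f x * inner ℝ (b x - w x) (gradient u x))
      ≤ Δt / 4 * (∫ x in M.moved A, f x ^ 2) + 1 / 4 * ∑ K ∈ M.cells, δ K *
        ∫ x in A '' cell K, inner ℝ (b x - w x) (gradient u x) ^ 2 := by
    rw [hA.integral_moved hfi, Finset.mul_sum, Finset.mul_sum, ← Finset.sum_add_distrib]
    refine Finset.sum_le_sum fun K hK => ?_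
    obtain ⟨Cw, hwK⟩ := hw K hK
    have hT := hA.isCompact_image hK
    -- The streamline derivative costs a quarter of its part of the norm; the remaining weight δ on
    -- f² is at most Δt/4.
    have h := (integral_mul_le_of_sq_le (α := 1) (β := 1 / 4) hT (hfK K hK)
      (memLp_top_streamline hT (hb.mono (image_cell_subset_moved hK)) hwK
        (hA.memLp_gradient hv hK)) fun s t => by nlinarith [sq_nonneg (s - t / 2)]).2
    have h3 := mul_le_mul_of_nonneg_left h (hδ0 K hK)
    have h4 : 0 ≤ ∫ x in A '' cell K, f x ^ 2 := integral_nonneg fun _ => sq_nonneg _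
    have h5 := mul_le_mul_of_nonneg_right (hδ3 K hK) h4
    linarith
  have h3 : 0 ≤ ∫ x in M.moved A, ‖gradient u x‖ ^ 2 := integral_nonneg fun _ => sq_nonneg _
  have h4 := mul_nonneg hε h3
  simp only [tripleSq, l2sq]
  linarith

end Load

/-! ### Time derivative and mesh velocity tested with the mean. -/

section TimeStep

variable {d : ℕ} {M : Mesh d} {A A₀ A₁ : Pt d → Pt d} {U₀ U₁ v : Pt d → ℝ}

/-- The conservative mesh velocity term, tested with the solution. -/
lemma integral_diverg_smul_mul (hA : IsALEMap M A) (hv : IsConforming M v) {w : Pt d → Pt d}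
    (hw : ∀ K ∈ M.cells, ∃ L, LipschitzOnWith L w (A '' cell K)) :
    2 * ∫ x in M.moved A, diverg (fun y => push M A v y • w y) x * push M A v x
      = ∫ x in M.moved A, push M A v x ^ 2 * diverg w x := by
  have hibp := hA.integral_inner_gradient_mul hv hw
  set u := push M A v with hu
  have h1 : ∀ᵐ x ∂(volume.restrict (M.moved A)), diverg (fun y => u y • w y) x * u x
      = diverg w x * u x ^ 2 + inner ℝ (w x) (gradient u x) * u x := by
    refine ae_moved fun K hK => ?_
    obtain ⟨D, hD⟩ := hw K hK
    filter_upwards [hA.ae_differentiableAt_push hv hK,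
      ae_differentiableAt_of_lipschitzOnWith (hA.measurableSet_image hK) (hA.ae_mem_interior hK)
        hD] with x hux hwx
    rw [diverg_smul hux hwx]
    ring
  have hi1 : IntegrableOn (fun x => diverg w x * u x ^ 2) (M.moved A) :=
    hA.integrableOn_moved fun K hK => by
      obtain ⟨D, hD⟩ := hw K hK
      have hu' := hA.memLp_push hv hK
      simp only [pow_two]
      exact integrableOn_of_memLp_top (hA.isCompact_image hK)
        (memLp_top_mul (memLp_top_diverg (hA.ae_mem_interior hK) hD) (memLp_top_mul hu' hu'))
  have hi2 : IntegrableOn (fun x => inner ℝ (w x) (gradient u x) * u x) (M.moved A) :=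
    hA.integrableOn_moved fun K hK => by
      obtain ⟨D, hD⟩ := hw K hK
      exact integrableOn_of_memLp_top (hA.isCompact_image hK)
        (memLp_top_mul (memLp_top_inner
          (memLp_top_of_lipschitzOnWith (hA.isCompact_image hK) hD)
          (hA.memLp_gradient hv hK)) (hA.memLp_push hv hK))
  have h2 : ∫ x in M.moved A, u x ^ 2 * diverg w x = ∫ x in M.moved A, diverg w x * u x ^ 2 := by
    simp only [mul_comm]
  rw [integral_congr_ae h1, integral_add hi1 hi2, h2]
  linarith

lemma IsALEMap.integrableOn_moved_push_sq (hA : IsALEMap M A) (hv : IsConforming M v) :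
    IntegrableOn (fun x => push M A v x ^ 2) (M.moved A) :=
  hA.integrableOn_moved fun _ hK => hA.integrableOn_push_sq hv hK

/-- Polarization, needed because the conservation law controls only squares: the product u₁u₀
becomes a difference of the squares of sum and difference. `push` is a precomposition, so the
identity passes to the moved domain pointwise. -/
lemma integral_push_mul_mean (hA : IsALEMap M A) {U W : Pt d → ℝ} (hU : IsConforming M U)
    (hs : IsConforming M fun Y => U₁ Y + U₀ Y) (hd : IsConforming M fun Y => U₁ Y - U₀ Y)
    (hW : ∀ Y, U Y * W Y
      = 1 / 2 * U Y ^ 2 + 1 / 8 * ((U₁ Y + U₀ Y) ^ 2 - (U₁ Y - U₀ Y) ^ 2)) :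
    ∫ x in M.moved A, push M A U x * push M A W x
      = 1 / 2 * l2sq (M.moved A) (push M A U)
        + 1 / 8 * (l2sq (M.moved A) (push M A fun Y => U₁ Y + U₀ Y)
          - l2sq (M.moved A) (push M A fun Y => U₁ Y - U₀ Y)) := by
  have hU' := hA.integrableOn_moved_push_sq hU
  have hs' := hA.integrableOn_moved_push_sq hs
  have hd' := hA.integrableOn_moved_push_sq hd
  have hsd : IntegrableOn (fun x => push M A (fun Y => U₁ Y + U₀ Y) x ^ 2
      - push M A (fun Y => U₁ Y - U₀ Y) x ^ 2) (M.moved A) := hs'.sub hd'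
  simp only [l2sq]
  rw [← integral_sub hs' hd', ← integral_const_mul, ← integral_const_mul,
    ← integral_add (hU'.const_mul _) (hsd.const_mul _)]
  exact integral_congr_ae (ae_of_all _ fun x => hW _)

/-- The terms of the scheme that come from the time derivative and the mesh velocity, tested with
the mean value of the solution. -/
lemma time_terms_lower_bound {Δt : ℝ} (hΔt : 0 ≤ Δt)
    (hA : ∀ θ ∈ Icc (0 : ℝ) 1, IsALEMap M (interp A₀ A₁ θ))
    (hU₀ : IsConforming M U₀) (hU₁ : IsConforming M U₁)
    (hs : IsConforming M fun Y => U₁ Y + U₀ Y) (hd : IsConforming M fun Y => U₁ Y - U₀ Y)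
    (hm : IsConforming M fun Y => (U₁ Y + U₀ Y) / 2)
    (hgcl : ∀ v, v = (fun Y => U₁ Y + U₀ Y) ∨ v = (fun Y => U₁ Y - U₀ Y) →
      l2sq (M.moved A₁) (push M A₁ v) - l2sq (M.moved A₀) (push M A₀ v)
        = Δt * ∫ x in M.moved (interp A₀ A₁ (1 / 2)),
          push M (interp A₀ A₁ (1 / 2)) v x ^ 2 * diverg (stepVel M Δt A₀ A₁) x) :
    l2sq (M.moved A₁) (push M A₁ U₁) - l2sq (M.moved A₀) (push M A₀ U₀)
        - Δt * (1 / 2 * linf (M.moved (interp A₀ A₁ (1 / 2))) (diverg (stepVel M Δt A₀ A₁))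
              * linf (M.moved A₁) (jac M A₁ (interp A₀ A₁ (1 / 2)))
              * l2sq (M.moved A₁) (push M A₁ U₁)
            + 1 / 2 * linf (M.moved (interp A₀ A₁ (1 / 2))) (diverg (stepVel M Δt A₀ A₁))
              * linf (M.moved A₀) (jac M A₀ (interp A₀ A₁ (1 / 2)))
              * l2sq (M.moved A₀) (push M A₀ U₀))
      ≤ 2 * ((∫ x in M.moved A₁, push M A₁ U₁ x * push M A₁ (fun Y => (U₁ Y + U₀ Y) / 2) x)
          - ∫ x in M.moved A₀, push M A₀ U₀ x * push M A₀ (fun Y => (U₁ Y + U₀ Y) / 2) x)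
        - 2 * (Δt * ∫ x in M.moved (interp A₀ A₁ (1 / 2)),
          diverg (fun y => push M (interp A₀ A₁ (1 / 2)) (fun Y => (U₁ Y + U₀ Y) / 2) y
            • stepVel M Δt A₀ A₁ y) x
            * push M (interp A₀ A₁ (1 / 2)) (fun Y => (U₁ Y + U₀ Y) / 2) x) := by
  have h₀ := hA 0 (by norm_num)
  have h₁ := hA 1 (by norm_num)
  rw [interp_zero] at h₀
  rw [interp_one] at h₁
  have h := hA (1 / 2) (by norm_num)
  have hw := fun K hK => exists_lipschitzOnWith_stepVel Δt hA (K := K) hK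
  have gs := hgcl _ (Or.inl rfl)
  have gd := hgcl _ (Or.inr rfl)
  have hP₁ := integral_push_mul_mean h₁ (W := fun Y => (U₁ Y + U₀ Y) / 2) hU₁ hs hd
    fun Y => by ring
  have hP₀ := integral_push_mul_mean h₀ (W := fun Y => (U₁ Y + U₀ Y) / 2) hU₀ hs hd
    fun Y => by ring
  have hdivm := integral_diverg_smul_mul h hm hw
  have hb₁ := l2sq_push_le h₁ h hU₁
  have hb₀ := l2sq_push_le h₀ h hU₀
  set B := interp A₀ A₁ (1 / 2) with hB
  set w := stepVel M Δt A₀ A₁ with hwdef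
  set ω := linf (M.moved B) (diverg w) with hω
  have hω0 : 0 ≤ ω := linf_nonneg _ _
  -- This quarter matches the coefficient of the sum in the polarized mass terms; the two cancel in
  -- the end.
  have hms : ∫ x in M.moved B, push M B (fun Y => (U₁ Y + U₀ Y) / 2) x ^ 2 * diverg w x
      = 1 / 4 * ∫ x in M.moved B, push M B (fun Y => U₁ Y + U₀ Y) x ^ 2 * diverg w x := by
    rw [← integral_const_mul]
    refine integral_congr_ae (ae_of_all _ fun x => ?_)
    simp only [push]
    ring
  -- The factor 2ω times the remaining Δt/4 gives the 1/2 in the definition of the β coefficients.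
  have hdd : ∫ x in M.moved B, push M B (fun Y => U₁ Y - U₀ Y) x ^ 2 * diverg w x
      ≤ 2 * ω * (l2sq (M.moved B) (push M B U₁) + l2sq (M.moved B) (push M B U₀)) := by
    have i₁ := h.integrableOn_moved_push_sq hU₁
    have i₀ := h.integrableOn_moved_push_sq hU₀
    have iD : IntegrableOn (fun x => push M B (fun Y => U₁ Y - U₀ Y) x ^ 2 * diverg w x)
        (M.moved B) := h.integrableOn_moved fun K hK => by
      obtain ⟨C, hC⟩ := hw K hK
      have hu' := h.memLp_push hd hK
      simp only [pow_two]
      exact integrableOn_of_memLp_top (h.isCompact_image hK)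
        (memLp_top_mul (memLp_top_mul hu' hu') (memLp_top_diverg (h.ae_mem_interior hK) hC))
    have hωae : ∀ᵐ x ∂(volume.restrict (M.moved B)), |diverg w x| ≤ ω :=
      ae_abs_le_linf_moved fun K hK => exists_ae_abs_diverg_le h hK (hw K hK)
    simp only [l2sq]
    rw [← integral_add i₁ i₀, ← integral_const_mul]
    refine integral_mono_ae iD ((i₁.add i₀).const_mul _) ?_
    filter_upwards [hωae] with x hx
    have e : push M B (fun Y => U₁ Y - U₀ Y) x = push M B U₁ x - push M B U₀ x := rfl
    rw [e]
    calc (push M B U₁ x - push M B U₀ x) ^ 2 * diverg w x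
        ≤ (push M B U₁ x - push M B U₀ x) ^ 2 * ω :=
          mul_le_mul_of_nonneg_left ((le_abs_self _).trans hx) (sq_nonneg _)
      _ ≤ (2 * (push M B U₁ x ^ 2 + push M B U₀ x ^ 2)) * ω :=
          mul_le_mul_of_nonneg_right
            (by nlinarith [sq_nonneg (push M B U₁ x + push M B U₀ x)]) hω0
      _ = _ := by ring
  have hdd' : Δt * ∫ x in M.moved B, push M B (fun Y => U₁ Y - U₀ Y) x ^ 2 * diverg w x
      ≤ Δt * (2 * ω * (linf (M.moved A₁) (jac M A₁ B) * l2sq (M.moved A₁) (push M A₁ U₁)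
        + linf (M.moved A₀) (jac M A₀ B) * l2sq (M.moved A₀) (push M A₀ U₀))) := by
    refine mul_le_mul_of_nonneg_left (hdd.trans ?_) hΔt
    exact mul_le_mul_of_nonneg_left (add_le_add hb₁ hb₀) (by positivity)
  rw [hP₁, hP₀]
  have hdivm' := congrArg (fun t => Δt * t) (hdivm.trans hms)
  linarith

end TimeStep

end ALESUPG

end

/-! ### The stability estimate. -/

open ALESUPG MeasureTheory in
theorem lemma4 {d : ℕ} (hd1 : 1 ≤ d) (hd3 : d ≤ 3)
    -- reference mesh and conforming finite element space
    (M : Mesh d) (V : Submodule ℝ (Pt d → ℝ)) (hVfin : FiniteDimensional ℝ V)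
    (hV : ∀ v ∈ V, IsConforming M v)
    -- time steps `0, …, N` of length `Δt`, ALE maps at the time levels `0, …, N + 1`
    (N : ℕ) (Δt : ℝ) (hΔt : 0 < Δt)
    (A : ℕ → Pt d → Pt d)
    (hA : ∀ n ≤ N, ∀ θ ∈ Set.Icc (0 : ℝ) 1, IsALEMap M (interp (A n) (A (n + 1)) θ))
    -- geometric conservation law of the midpoint rule (automatic for `d ≤ 2`)
    (hGCL : d = 3 → ∀ n ≤ N, ∀ v ∈ V,
      l2sq (M.moved (A (n + 1))) (push M (A (n + 1)) v) - l2sq (M.moved (A n)) (push M (A n) v)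
        = Δt * ∫ x in M.moved (midMap A n),
            (push M (midMap A n) v x) ^ 2 * diverg (meshVel M Δt A n) x)
    -- data
    (ε μ : ℝ) (hε : 0 < ε) (hμ : 0 < μ)
    (b : ℝ → Pt d → Pt d) (c f : ℝ → Pt d → ℝ)
    (hb : ∀ n ≤ N, ∃ L, LipschitzOnWith L (b (midTime Δt n)) (M.moved (midMap A n)))
    (hc : ∀ n ≤ N, MemLp (c (midTime Δt n)) ⊤ (volume.restrict (M.moved (midMap A n))))
    (hf : ∀ n ≤ N, MemLp (f (midTime Δt n)) 2 (volume.restrict (M.moved (midMap A n))))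
    (hcoer : ∀ n ≤ N, ∀ᵐ x ∂(volume.restrict (M.moved (midMap A n))),
      μ ≤ c (midTime Δt n) x - 1 / 2 * diverg (b (midTime Δt n)) x)
    -- inverse inequality and assumptions on the stabilization parameters
    (cinv : ℝ) (hcinv : 0 ≤ cinv)
    (hinv : ∀ n ≤ N, ∀ v ∈ V, ∀ K ∈ M.cells,
      Metric.diam (midMap A n '' cell K) ^ 2 *
          (∫ x in midMap A n '' cell K, (Laplacian.laplacian (push M (midMap A n) v) x) ^ 2)
        ≤ cinv ^ 2 * ∫ x in midMap A n '' cell K, ‖gradient (push M (midMap A n) v) x‖ ^ 2)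
    (δ : ℕ → Finset (Pt d) → ℝ)
    (hδ0 : ∀ n ≤ N, ∀ K ∈ M.cells, 0 ≤ δ n K)
    (hδ1 : ∀ n ≤ N, ∀ K ∈ M.cells,
      2 * linf (midMap A n '' cell K) (c (midTime Δt n)) ^ 2 * δ n K ≤ μ)
    (hδ2 : ∀ n ≤ N, ∀ K ∈ M.cells,
      2 * ε * cinv ^ 2 * δ n K ≤ Metric.diam (midMap A n '' cell K) ^ 2)
    (hδ3 : ∀ n ≤ N, ∀ K ∈ M.cells, δ n K ≤ Δt / 4)
    -- the discrete solution
    (u : ℕ → Pt d → ℝ) (hu : ∀ n ≤ N + 1, u n ∈ V)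
    (hscheme : ∀ n ≤ N, CNStep M V A δ Δt ε b c f u n)
    -- time-step restriction
    (hstep : ∀ n ∈ Finset.Icc 1 (N + 1),
      Δt * (betaOne M Δt A n + betaTwo M Δt A N n) < 1) :
    (l2sq (M.moved (A (N + 1))) (push M (A (N + 1)) (u (N + 1)))
        + Δt / 8 * ∑ n ∈ Finset.range (N + 1),
            tripleSq M (midMap A n) (δ n) ε μ (b (midTime Δt n)) (meshVel M Δt A n)
              (push M (midMap A n) (fun Y => u (n + 1) Y + u n Y))
      ≤ ((1 + Δt * betaTwo M Δt A N 0) * l2sq (M.moved (A 0)) (push M (A 0) (u 0))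
          + Δt * ∑ n ∈ Finset.range (N + 1),
              (2 / μ + Δt / 2) * l2sq (M.moved (midMap A n)) (f (midTime Δt n)))
        * Real.exp (Δt * ∑ n ∈ Finset.Icc 1 (N + 1),
            (betaOne M Δt A n + betaTwo M Δt A N n)
              / (1 - Δt * (betaOne M Δt A n + betaTwo M Δt A N n))))
    ∧ ((∀ n ≤ N, ∀ᵐ x ∂(volume.restrict (M.moved (midMap A n))), f (midTime Δt n) x = 0) →
      l2sq (M.moved (A (N + 1))) (push M (A (N + 1)) (u (N + 1)))
        + Δt / 4 * ∑ n ∈ Finset.range (N + 1),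
            tripleSq M (midMap A n) (δ n) ε μ (b (midTime Δt n)) (meshVel M Δt A n)
              (push M (midMap A n) (fun Y => u (n + 1) Y + u n Y))
      ≤ (1 + Δt * betaTwo M Δt A N 0) * l2sq (M.moved (A 0)) (push M (A 0) (u 0))
        * Real.exp (Δt * ∑ n ∈ Finset.Icc 1 (N + 1),
            (betaOne M Δt A n + betaTwo M Δt A N n)
              / (1 - Δt * (betaOne M Δt A n + betaTwo M Δt A N n)))) := by
  have hmid : ∀ n ≤ N, IsALEMap M (midMap A n) := fun n hn => hA n hn (1 / 2) (by norm_num)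
  have hw : ∀ n ≤ N, ∀ K ∈ M.cells, ∃ C, LipschitzOnWith C (meshVel M Δt A n)
      (midMap A n '' cell K) := fun n hn K hK => exists_lipschitzOnWith_stepVel Δt (hA n hn) hK
  have hsV : ∀ n ≤ N, (fun Y => u (n + 1) Y + u n Y) ∈ V := fun n hn =>
    V.add_mem (hu _ (by omega)) (hu _ (by omega))
  have hdV : ∀ n ≤ N, (fun Y => u (n + 1) Y - u n Y) ∈ V := fun n hn =>
    V.sub_mem (hu _ (by omega)) (hu _ (by omega))
  have hmV : ∀ n ≤ N, (fun Y => (u (n + 1) Y + u n Y) / 2) ∈ V := fun n hn => by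
    have h := V.smul_mem (1 / 2 : ℝ) (hsV n hn)
    convert h using 1
    funext Y
    simp only [Pi.smul_apply, smul_eq_mul]
    ring
  set a : ℕ → ℝ := fun n => l2sq (M.moved (A n)) (push M (A n) (u n)) with ha
  set T : ℕ → ℝ := fun n => tripleSq M (midMap A n) (δ n) ε μ (b (midTime Δt n))
    (meshVel M Δt A n) (push M (midMap A n) (fun Y => u (n + 1) Y + u n Y)) with hT
  have hT0 : ∀ n ≤ N, 0 ≤ T n := fun n hn =>
    tripleSq_nonneg _ _ hε.le hμ.le (hδ0 n hn) _ _ _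
  -- The estimate concerns the sum while the test function is the mean, hence the factor 4.
  have hscale : ∀ n, T n = 2 ^ 2 * tripleSq M (midMap A n) (δ n) ε μ (b (midTime Δt n))
      (meshVel M Δt A n) (push M (midMap A n) (fun Y => (u (n + 1) Y + u n Y) / 2)) := fun n => by
    rw [← tripleSq_const_mul]
    simp only [hT]
    congr 1
    funext x
    simp only [push]
    ring
  have hβ₁ : ∀ n, 0 ≤ betaOne M Δt A n := by
    rintro (_ | n)
    · exact le_rfl
    · exact mul_nonneg (mul_nonneg (by norm_num) (linf_nonneg _ _)) (linf_nonneg _ _)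
  have hβ₂ : ∀ n, 0 ≤ betaTwo M Δt A N n := fun n => by
    unfold betaTwo
    split_ifs
    · exact mul_nonneg (mul_nonneg (by norm_num) (linf_nonneg _ _)) (linf_nonneg _ _)
    · exact le_rfl
  -- The one-step energy inequality keeps the load unestimated, so that it serves both the general
  -- case and f = 0.
  have henergy : ∀ n ≤ N, a (n + 1) - a n + Δt / 4 * T n
      ≤ Δt * (betaOne M Δt A (n + 1) * a (n + 1) + betaTwo M Δt A N n * a n)
        + 2 * Δt * ((∫ x in M.moved (midMap A n), f (midTime Δt n) x
              * push M (midMap A n) (fun Y => (u (n + 1) Y + u n Y) / 2) x)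
            + ∑ K ∈ M.cells, δ n K * ∫ x in midMap A n '' cell K, f (midTime Δt n) x
              * inner ℝ (b (midTime Δt n) x - meshVel M Δt A n x) (gradient
                (push M (midMap A n) (fun Y => (u (n + 1) Y + u n Y) / 2)) x)) := by
    intro n hn
    have hco := half_tripleSq_le_aSUPG hd1 (hmid n hn) (hV _ (hmV n hn)) hε.le (hb n hn)
      (hw n hn) (hc n hn) (hcoer n hn) (hinv n hn _ (hmV n hn)) (hδ0 n hn) (hδ1 n hn) (hδ2 n hn)
    have htime := time_terms_lower_bound hΔt.le (hA n hn) (hV _ (hu n (by omega)))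
      (hV _ (hu (n + 1) (by omega))) (hV _ (hsV n hn)) (hV _ (hdV n hn)) (hV _ (hmV n hn))
      fun v hv => by
        have hvV : v ∈ V := by
          rcases hv with rfl | rfl
          · exact hsV n hn
          · exact hdV n hn
        by_cases hd : d = 3
        · exact hGCL hd n hn v hvV
        · exact geometric_conservation (by omega) hΔt.ne' (hA n hn) (hV v hvV)
    have hsch := hscheme n hn _ (hmV n hn)
    simp only at hsch
    have hload : ∀ K, δ n K * ∫ x in midMap A n '' cell K, Δt * f (midTime Δt n) x
          * inner ℝ (b (midTime Δt n) x - meshVel M Δt A n x) (gradient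
            (push M (midMap A n) (fun Y => (u (n + 1) Y + u n Y) / 2)) x)
        = Δt * (δ n K * ∫ x in midMap A n '' cell K, f (midTime Δt n) x
          * inner ℝ (b (midTime Δt n) x - meshVel M Δt A n x) (gradient
            (push M (midMap A n) (fun Y => (u (n + 1) Y + u n Y) / 2)) x)) := fun K => by
      simp only [mul_assoc, integral_const_mul]
      ring
    simp only [hload, ← Finset.mul_sum] at hsch
    have hβ : betaTwo M Δt A N n = 1 / 2 * linf (M.moved (midMap A n)) (diverg (meshVel M Δt A n))
      * linf (M.moved (A n)) (jac M (A n) (midMap A n)) := if_pos hn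
    have hco' := mul_le_mul_of_nonneg_left hco hΔt.le
    rw [hβ]
    rw [hscale]
    change l2sq _ _ - l2sq _ _ + Δt / 4 * _
      ≤ Δt * (1 / 2 * linf (M.moved (midMap A n)) (diverg (meshVel M Δt A n))
        * linf (M.moved (A (n + 1))) (jac M (A (n + 1)) (midMap A n)) * l2sq _ _
        + 1 / 2 * linf (M.moved (midMap A n)) (diverg (meshVel M Δt A n))
        * linf (M.moved (A n)) (jac M (A n) (midMap A n)) * l2sq _ _) + _
    change l2sq _ _ - l2sq _ _ - Δt * (1 / 2 * linf (M.moved (midMap A n))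
        (diverg (meshVel M Δt A n)) * linf (M.moved (A (n + 1))) (jac M (A (n + 1)) (midMap A n))
        * l2sq _ _ + 1 / 2 * linf (M.moved (midMap A n)) (diverg (meshVel M Δt A n))
        * linf (M.moved (A n)) (jac M (A n) (midMap A n)) * l2sq _ _)
      ≤ _ - 2 * (Δt * ∫ x in M.moved (midMap A n), diverg (fun y => push M (midMap A n)
        (fun Y => (u (n + 1) Y + u n Y) / 2) y • meshVel M Δt A n y) x
          * push M (midMap A n) (fun Y => (u (n + 1) Y + u n Y) / 2) x) at htime
    linarith
  refine ⟨?_, fun hf0 => ?_⟩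
  · have h := discrete_gronwall (D := fun n => Δt / 8 * T n)
      (F := fun n => Δt * ((2 / μ + Δt / 2) * l2sq (M.moved (midMap A n)) (f (midTime Δt n))))
      hΔt.le (fun n => l2sq_nonneg _ _ : ∀ n, 0 ≤ a n)
      (fun n hn => mul_nonneg (by positivity) (hT0 n hn))
      (fun n _ => mul_nonneg hΔt.le (mul_nonneg (by positivity) (l2sq_nonneg _ _)))
      hβ₁ hβ₂ hstep fun n hn => ?_
    · rwa [← Finset.mul_sum, ← Finset.mul_sum] at h
    · have hl := load_le (hmid n hn) (hV _ (hmV n hn)) hε.le hμ (hb n hn) (hw n hn) (hf n hn)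
        (hδ0 n hn) (hδ3 n hn)
      have he := henergy n hn
      have hscale := hscale n
      -- After this doubling the load costs Δt/2 times the squared norm of the mean, which is Δt/8
      -- times `T n`: half of the dissipation.
      have hl' := mul_le_mul_of_nonneg_left hl (by positivity : 0 ≤ 2 * Δt)
      have e2 : 2 / μ = 2 * (1 / μ) := by ring
      rw [e2]
      nlinarith
  · have h := discrete_gronwall (D := fun n => Δt / 4 * T n) (F := fun _ => 0)
      hΔt.le (fun n => l2sq_nonneg _ _ : ∀ n, 0 ≤ a n)
      (fun n hn => mul_nonneg (by positivity) (hT0 n hn)) (fun _ _ => le_rfl)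
      hβ₁ hβ₂ hstep fun n hn => ?_
    · rwa [← Finset.mul_sum, Finset.sum_const_zero, add_zero] at h
    · have he := henergy n hn
      have h1 : ∫ x in M.moved (midMap A n), f (midTime Δt n) x
          * push M (midMap A n) (fun Y => (u (n + 1) Y + u n Y) / 2) x = 0 := by
        refine integral_eq_zero_of_ae ?_
        filter_upwards [hf0 n hn] with x hx
        simp [hx]
      have h2 : ∀ K ∈ M.cells, δ n K * ∫ x in midMap A n '' cell K, f (midTime Δt n) x
          * inner ℝ (b (midTime Δt n) x - meshVel M Δt A n x) (gradient
            (push M (midMap A n) (fun Y => (u (n + 1) Y + u n Y) / 2)) x) = 0 := fun K hK => by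
        rw [integral_eq_zero_of_ae, mul_zero]
        filter_upwards [ae_image_cell hK (hf0 n hn)] with x hx
        simp [hx]
      rw [h1, Finset.sum_eq_zero h2] at he
      simpa using he
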